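/- Let $n \ge 0$. For finite-dimensional complex inner product spaces $V, W$ let $\mathcal{J}(V,W)$ be the space of complex linear isometries $V \to W$. Let $S\gamma_{n+1}(V,W)$ be the space of pairs $(f,x)$ with $f \in \mathcal{J}(V,W)$, $x \in \mathbb{C}^{n+1}\otimes f(V)^\perp$ and $\|x\| = 1$, that is, the unit sphere bundle of the vector bundle $\gamma_{n+1}(V,W)$ over $\mathcal{J}(V,W)$ with fibre $\mathbb{C}^{n+1}\otimes f(V)^\perp$ over $f$. Let $\operatorname{hocolim}_{0\neq U\subseteq\mathbb{C}^{n+1}} \mathcal{J}(U\oplus V,W)$ be the geometric realisation of the simplicial space whose $k$-simplices are pairs $(G,z)$, where $G(0)\supseteq G(1)\supseteq\dots\supseteq G(k)$ is a chain of nonzero subspaces of $\mathbb{C}^{n+1}$ and $z\in\mathcal{J}(G(0)\oplus V,W)$ (orthogonal direct sum). It is topologised as a fibre bundle over the space of such chains, with the topology coming from the Grassmannians. A monotone map $\theta:[l]\to[k]$ sends $(G,z)$ to $(G\circ\theta,\, z|_{G(\theta(0))\oplus V})$. Then there are homeomorphisms \[ \Phi_{V,W}:\ \operatorname*{hocolim}_{0\neq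 U\subseteq\mathbb{C}^{n+1}}\mathcal{J}(U\oplus V,W)\ \xrightarrow{\ \cong\ }\ S\gamma_{n+1}(V,W) \] for all $V$ and $W$, with the following two properties. (1) They are natural in $V$ and $W$. For linear isometries $g:V'\to V$ and $h:W\to W'$ they intertwine the map induced by $(G,z)\mapsto (G,\, h\circ z\circ(\mathrm{id}\oplus g))$ with the map $(f,x)\mapsto (hfg,\,(\mathrm{id}\otimes h)x)$. (2) They are given by the spectral decomposition of $x^*x$. Regard $x$ as a linear map $\mathbb{C}^{n+1}\to f(V)^\perp$ by means of $\mathbb{C}^{n+1}\otimes f(V)^\perp\cong(\mathbb{C}^{n+1})^*\otimes f(V)^\perp\cong\operatorname{Hom}(\mathbb{C}^{n+1},f(V)^\perp)$ (using the standard basis). Let $0<\lambda_0<\dots<\lambda_k$ be the distinct nonzero eigenvalues of $x^*x$, with eigenspaces $E(\lambda_i)\subseteq\mathbb{C}^{n+1}$. Then $\Phi_{V,W}^{-1}(f,x)$ is the class of $(G,z,p)$, where $G(r)=E(\lambda_r)\oplus\dots\oplus E(\lambda_k)$; $z$ is $f$ on $V$ and $\lambda_i^{-1/2}x$ on $E(\lambda_i)$;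 and $p\in\Delta^k$ has barycentric coordinates $\lambda_k^{-1}(\lambda_0,\lambda_1-\lambda_0,\dots,\lambda_k-\lambda_{k-1})$. -/

import Mathlib

universe u v

noncomputable section

namespace UnitaryCalculus

open scoped TensorProduct InnerProductSpace

/-- The standard Hermitian space `ℂ^m`. -/
abbrev Cn (m : ℕ) : Type := EuclideanSpace ℂ (Fin m)

/-! ### The topological poset of nonzero subspaces of `ℂ^m` -/

/-- The poset of nonzero complex subspaces of `ℂ^m`, ordered by inclusion. -/
abbrev NonzeroSubspace (m : ℕ) : Type := {U : Submodule ℂ (Cn m) // U ≠ ⊥}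

/-- The Grassmannian topology: a subspace is identified with the orthogonal projection onto it.
(The rank of a projection is its trace, so this is the disjoint union of the Grassmannians.) -/
instance (m : ℕ) : TopologicalSpace (NonzeroSubspace m) :=
  TopologicalSpace.induced (fun U => (U.1.starProjection : Cn m →L[ℂ] Cn m)) inferInstance

/-- The inclusion of a smaller subspace into a larger one, as a linear isometry. -/
def inclusionIsometry {m : ℕ} {U U' : Submodule ℂ (Cn m)} (h : U ≤ U') : U →ₗᵢ[ℂ] U' where
  toLinearMap := Submodule.inclusion h
  norm_map' := fun _ => rfl

section

variable {V V' : Type u} {W W' : Type v}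
  [NormedAddCommGroup V] [InnerProductSpace ℂ V]
  [NormedAddCommGroup V'] [InnerProductSpace ℂ V']
  [NormedAddCommGroup W] [InnerProductSpace ℂ W]
  [NormedAddCommGroup W'] [InnerProductSpace ℂ W']

/-! ### The homotopy colimit -/

variable (V W) in
/-- The `k`-simplices of the simplicial bar construction of the contravariant functor
`U ↦ 𝒥(U ⊕ V, W)` on the poset of nonzero subspaces of `ℂ^m`: chains `G 0 ⊇ G 1 ⊇ ⋯ ⊇ G k` of
nonzero subspaces together with a linear isometry `z : G 0 ⊕ V → W`, where `⊕` is the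
orthogonal direct sum. -/
@[ext] structure BarSimplex (m k : ℕ) where
  chain : Fin (k + 1) → NonzeroSubspace m
  antitone : Antitone chain
  z : WithLp 2 ((chain 0).1 × V) →ₗᵢ[ℂ] W

namespace BarSimplex

variable {m k l : ℕ}

/-- The part of `z` on the subspace `G 0`, extended by zero to `ℂ^m`
along the orthogonal projection. -/
def zLeft (b : BarSimplex V W m k) : Cn m →L[ℂ] W :=
  b.z.toContinuousLinearMap ∘L
    (WithLp.prodContinuousLinearEquiv 2 ℂ (b.chain 0).1 V).symm.toContinuousLinearMap ∘L
      ContinuousLinearMap.inl ℂ (b.chain 0).1 V ∘L (b.chain 0).1.orthogonalProjectionOnto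

/-- The restriction of `z` to `V`, as a linear isometry. -/
def zRight (b : BarSimplex V W m k) : V →ₗᵢ[ℂ] W where
  toFun v := b.z (WithLp.toLp 2 (0, v))
  map_add' v v' := by
    rw [← map_add, ← WithLp.toLp_add, Prod.mk_add_mk, add_zero]
  map_smul' c v := by
    rw [RingHom.id_apply, ← map_smul, ← WithLp.toLp_smul, Prod.smul_mk, smul_zero]
  norm_map' v := by
    refine (b.z.norm_map _).trans ?_
    simp

/-- The topology of the space of `k`-simplices: the chain varies in the space of flags of
nonzero subspaces of `ℂ^m`, and `z` varies in the bundle of Stiefel manifolds over it. -/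
instance : TopologicalSpace (BarSimplex V W m k) :=
  TopologicalSpace.induced
    (fun b : BarSimplex V W m k => (b.chain, b.zLeft, b.zRight.toContinuousLinearMap))
    (inferInstance : TopologicalSpace
      ((Fin (k + 1) → NonzeroSubspace m) × (Cn m →L[ℂ] W) × (V →L[ℂ] W)))

/-- The simplicial operator of a monotone map `θ : [l] → [k]`: reindex the chain and restrict
the isometry to the new first term of the chain. -/
def pull (θ : Fin (l + 1) →o Fin (k + 1)) (b : BarSimplex V W m k) : BarSimplex V W m l where
  chain := b.chain ∘ θ
  antitone := b.antitone.comp_monotone θ.monotone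
  z := b.z.comp ((inclusionIsometry (b.antitone (Fin.zero_le (θ 0)))).withLpProdMap 2
    (LinearIsometry.id : V →ₗᵢ[ℂ] V))

/-- Functoriality: precompose with an isometry `g : V' → V`, postcompose with `h : W → W'`. -/
def map (g : V' →ₗᵢ[ℂ] V) (h : W →ₗᵢ[ℂ] W') (b : BarSimplex V W m k) :
    BarSimplex V' W' m k where
  chain := b.chain
  antitone := b.antitone
  z := h.comp (b.z.comp
    ((LinearIsometry.id : (b.chain 0).1 →ₗᵢ[ℂ] (b.chain 0).1).withLpProdMap 2 g))

theorem map_pull (g : V' →ₗᵢ[ℂ] V) (h : W →ₗᵢ[ℂ] W') (θ : Fin (l + 1) →o Fin (k + 1))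
    (b : BarSimplex V W m k) : (b.pull θ).map g h = (b.map g h).pull θ := rfl

end BarSimplex

variable (V W) in
/-- The disjoint union over `k` of (`k`-simplices) `×` (topological `k`-simplex). -/
abbrev PreHocolim (m : ℕ) : Type (max u v) :=
  Σ k : ℕ, BarSimplex V W m k × stdSimplex ℝ (Fin (k + 1))

variable (V W) in
/-- The identifications of the geometric realisation: `(θ^* b, p) ∼ (b, θ_* p)` for every
monotone `θ : [l] → [k]` (in particular for all face and degeneracy operators). -/
inductive HocolimRel (m : ℕ) : PreHocolim V W m → PreHocolim V W m → Prop
  | glue {k l : ℕ} (θ : Fin (l + 1) →o Fin (k + 1)) (b : BarSimplex V W m k)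
      (p : stdSimplex ℝ (Fin (l + 1))) :
      HocolimRel m ⟨l, b.pull θ, p⟩ ⟨k, b, stdSimplex.map θ p⟩

variable (V W) in
/-- The homotopy colimit over the topological poset of nonzero `U ⊆ ℂ^m` of `𝒥(U ⊕ V, W)`: the
geometric realisation of the simplicial bar construction, with the quotient topology. -/
def Hocolim (m : ℕ) : Type (max u v) := Quot (HocolimRel V W m)

instance (m : ℕ) : TopologicalSpace (Hocolim V W m) :=
  inferInstanceAs (TopologicalSpace (Quot (HocolimRel V W m)))

namespace Hocolim

variable {m : ℕ}

/-- The point of the homotopy colimit represented by a simplex and barycentric coordinates. -/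
def mk {k : ℕ} (b : BarSimplex V W m k) (p : stdSimplex ℝ (Fin (k + 1))) : Hocolim V W m :=
  Quot.mk _ ⟨k, b, p⟩

/-- Functoriality of the homotopy colimit, contravariant in `V` and covariant in `W`. -/
def map (g : V' →ₗᵢ[ℂ] V) (h : W →ₗᵢ[ℂ] W') : Hocolim V W m → Hocolim V' W' m :=
  Quot.map (fun a => ⟨a.1, a.2.1.map g h, a.2.2⟩) (by
    rintro _ _ ⟨θ, b, p⟩
    exact HocolimRel.glue θ (b.map g h) p)

end Hocolim

/-! ### The sphere bundle -/

variable (V W) in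
/-- The total space `γ_m(V, W) = {(f, x) : f ∈ 𝒥(V, W), x ∈ ℂ^m ⊗ f(V)^⊥}` of the `m`-th
complement bundle. -/
structure ComplementBundle (m : ℕ) where
  f : V →ₗᵢ[ℂ] W
  x : Cn m ⊗[ℂ] ↥((LinearMap.range f.toLinearMap)ᗮ)

/-- `γ_m(V, W)` has the topology of a subspace of `𝒥(V, W) × (ℂ^m ⊗ W)`. -/
instance (m : ℕ) : TopologicalSpace (ComplementBundle V W m) :=
  TopologicalSpace.induced
    (fun q : ComplementBundle V W m => (q.f.toContinuousLinearMap,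
      LinearMap.lTensor (Cn m) (LinearMap.range q.f.toLinearMap)ᗮ.subtype q.x))
    (inferInstance : TopologicalSpace ((V →L[ℂ] W) × (Cn m ⊗[ℂ] W)))

/-- A linear isometry `h : W → W'` maps `f(V)^⊥` to `(h f g (V'))^⊥`. -/
def complementMap (f : V →ₗᵢ[ℂ] W) (g : V' →ₗᵢ[ℂ] V) (h : W →ₗᵢ[ℂ] W') :
    ↥((LinearMap.range f.toLinearMap)ᗮ) →ₗᵢ[ℂ]
      ↥((LinearMap.range (h.comp (f.comp g)).toLinearMap)ᗮ) where
  toLinearMap := h.toLinearMap.restrict (by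
    intro w hw
    rw [Submodule.mem_orthogonal] at hw ⊢
    rintro _ ⟨v, rfl⟩
    exact (h.inner_map_map (f (g v)) w).trans (hw (f (g v)) ⟨g v, rfl⟩))
  norm_map' := fun w => h.norm_map w

variable (V W) in
/-- The (unit) sphere bundle `Sγ_m(V, W)`, with the subspace topology. -/
abbrev SphereBundle (m : ℕ) : Type (max u v) := {q : ComplementBundle V W m // ‖q.x‖ = 1}

/-- Functoriality of the sphere bundle: `(f, x) ↦ (h f g, (id ⊗ h) x)`. -/
def SphereBundle.map {m : ℕ} (g : V' →ₗᵢ[ℂ] V) (h : W →ₗᵢ[ℂ] W') (s : SphereBundle V W m) :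
    SphereBundle V' W' m :=
  ⟨{ f := h.comp (s.1.f.comp g)
     x := (complementMap s.1.f g h).lTensor (Cn m) s.1.x }, by
    rw [LinearIsometry.norm_map, s.2]⟩

/-! ### The spectral decomposition -/

/-- The identification `ℂ^m ⊗ E ≅ (ℂ^m)^* ⊗ E ≅ Hom(ℂ^m, E)`, where `ℂ^m ≅ (ℂ^m)^*` by means of
the standard basis. -/
def tensorToHom (m : ℕ) (E : Type v) [AddCommGroup E] [Module ℂ E] :
    Cn m ⊗[ℂ] E →ₗ[ℂ] (Cn m →ₗ[ℂ] E) :=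
  dualTensorHom ℂ (Cn m) E ∘ₗ
    LinearMap.rTensor E (EuclideanSpace.basisFun (Fin m) ℂ).toBasis.toDual

variable [FiniteDimensional ℂ W]

/-- The element `x` of the fibre over `f`, regarded as a linear map `ℂ^m → f(V)^⊥`. -/
def ComplementBundle.hom {m : ℕ} (q : ComplementBundle V W m) :
    Cn m →ₗ[ℂ] ↥((LinearMap.range q.f.toLinearMap)ᗮ) :=
  tensorToHom m _ q.x

/-- The self-adjoint endomorphism `x^* x` of `ℂ^m`. -/
def ComplementBundle.gram {m : ℕ} (q : ComplementBundle V W m) : Module.End ℂ (Cn m) :=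
  LinearMap.adjoint q.hom ∘ₗ q.hom

/-- The spectral data of a point `(f, x)` of `γ_m(V, W)`: the nonzero eigenvalues
`0 < λ_0 < ⋯ < λ_k` of `x^* x`, the chain `G r = E(λ_r) ⊕ ⋯ ⊕ E(λ_k)`, the isometry `z` which is
`f` on `V` and `λ_i^{-1/2} x` on `E(λ_i)`, and the barycentric coordinates
`λ_k⁻¹ (λ_0, λ_1 - λ_0, …, λ_k - λ_{k-1})`. -/
structure IsSpectralData {m k : ℕ} (q : ComplementBundle V W m) (lam : Fin (k + 1) → ℝ)
    (b : BarSimplex V W m k) (p : stdSimplex ℝ (Fin (k + 1))) : Prop where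
  pos : ∀ i, 0 < lam i
  strictMono : StrictMono lam
  eigenvalue_iff : ∀ μ : ℂ, (μ ≠ 0 ∧ q.gram.HasEigenvalue μ) ↔ ∃ i, μ = (lam i : ℂ)
  chain_eq : ∀ r, (b.chain r).1 = ⨆ i, ⨆ _ : r ≤ i, q.gram.eigenspace (lam i : ℂ)
  z_right : ∀ v : V, b.z (WithLp.toLp 2 (0, v)) = q.f v
  z_left : ∀ i, ∀ c : (b.chain 0).1, (c : Cn m) ∈ q.gram.eigenspace (lam i : ℂ) →
    b.z (WithLp.toLp 2 (c, 0)) = (((Real.sqrt (lam i))⁻¹ : ℝ) : ℂ) • (q.hom c : W)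
  weight_zero : p.1 0 = lam 0 / lam (Fin.last k)
  weight_succ : ∀ i : Fin k,
    p.1 i.succ = (lam i.succ - lam i.castSucc) / lam (Fin.last k)

end

end UnitaryCalculus

end

/-! The homeomorphism is polar decomposition. A simplex `(G, z)` with weights `p` gives the positive
operator `S = ∑ pᵢ P_{G i}` on `ℂ^m` (`chainOperator`) and the map `z ∘ √S : ℂ^m → z(V)ᗮ` (`polar`).
Rescaling to tensor norm one gives a point of the sphere bundle. Reindexing a chain along `θ` has
the same effect on `S` as pushing the weights forward (`chainOperator_comp`), so the construction
respects the gluing (`polar_pull`). Composition with isometries leaves `S` unchanged, which gives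
naturality.

Conversely, the operator `x^* x` of the image is a positive multiple of `S` (`toSphere_gram`). If
the chain is strict and the weights are positive, then `S` acts on the complement of `G (i + 1)` in
`G i` by `p 0 + ⋯ + p i`. These numbers increase strictly, so the eigenspaces recover `G`, the
eigenvalues recover `p`, and the isometric factor of `x` recovers `z`
(`IsNondegenerate.isSpectralData`). Every point has such a nondegenerate representative and spectral
data are unique (`IsSpectralData.mk_eq_mk`), hence injectivity. Surjectivity comes from
`SphereBundle.exists_isSpectralData` and `IsSpectralData.toSphere_eq`. The weights are normalised by
the largest eigenvalue but the sphere by the tensor norm, so points are compared up to a positive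
factor (`SphereBundle.ext_of_smul`).

Continuity of the inverse is never checked directly: the source is compact, because only simplices
of dimension below `m` matter and each space of simplices is compact, and the target is Hausdorff.
-/

noncomputable section

namespace UnitaryCalculus

open scoped TensorProduct InnerProductSpace

/-! ### Symmetric operators, orthogonal families of subspaces and square roots. -/

section LinearAlgebra

variable {E F : Type*} [NormedAddCommGroup E] [InnerProductSpace ℂ E]
  [AddCommGroup F] [Module ℂ F] {ι : Type*}

theorem orthogonal_le_of_isOrtho_family {D : ι → Submodule ℂ E} {v : E}
    (h : ∀ i, ∀ e ∈ D i, ⟪e, v⟫_ℂ = 0) : v ∈ (⨆ i, D i)ᗮ := by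
  rw [← Submodule.iInf_orthogonal, Submodule.mem_iInf]
  exact fun i => (Submodule.mem_orthogonal _ _).2 (h i)

theorem inner_eq_zero_of_eigenspace {T : E →ₗ[ℂ] E} (hT : T.IsSymmetric) {μ ν : ℂ} (h : μ ≠ ν)
    {u v : E} (hu : u ∈ Module.End.eigenspace T μ) (hv : v ∈ Module.End.eigenspace T ν) :
    ⟪u, v⟫_ℂ = 0 :=
  (Submodule.isOrtho_iff_inner_eq.1 (hT.orthogonalFamily_eigenspaces.isOrtho h)) u hu v hv

theorem isOrtho_iSup_of_notMem {k : ℕ} {D : Fin (k + 1) → Submodule ℂ E}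
    (hD : ∀ i j, i ≠ j → D i ⟂ D j) {i r : Fin (k + 1)} (h : i < r) :
    D i ⟂ ⨆ j, ⨆ _ : r ≤ j, D j := by
  simp only [Submodule.isOrtho_iSup_right]
  exact fun j hj => hD i j (h.trans_le hj).ne

/-- An eigenvector for any other eigenvalue would be orthogonal to every `D i`, hence killed by `T`,
which a nonzero eigenvalue forbids. -/
theorem exists_eq_of_hasEigenvalue {T : E →ₗ[ℂ] E} (hT : T.IsSymmetric) {D : ι → Submodule ℂ E}
    {lam : ι → ℝ} (hD : ∀ i, ∀ e ∈ D i, T e = (lam i : ℂ) • e)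
    (h0 : ∀ e ∈ (⨆ i, D i)ᗮ, T e = 0) {μ : ℂ} (hμ : μ ≠ 0)
    (h : Module.End.HasEigenvalue T μ) : ∃ i, μ = (lam i : ℂ) := by
  by_contra! hcon
  obtain ⟨v, hv⟩ := h.exists_hasEigenvector
  have : T v = 0 := h0 _ (orthogonal_le_of_isOrtho_family fun j e he =>
    inner_eq_zero_of_eigenspace hT (hcon j).symm (Module.End.mem_eigenspace_iff.2 (hD j e he)) hv.1)
  rw [hv.apply_eq_smul] at this
  exact (smul_ne_zero hμ hv.2) this

variable [FiniteDimensional ℂ E]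

/-- Linear maps which agree on the terms of a family of subspaces and on the orthogonal complement
of their sum are equal. -/
theorem eq_of_eqOn_family (D : ι → Submodule ℂ E) {A B : E →ₗ[ℂ] F}
    (h : ∀ i, ∀ e ∈ D i, A e = B e) (h0 : ∀ e ∈ (⨆ i, D i)ᗮ, A e = B e) : A = B := by
  rw [← LinearMap.eqLocus_eq_top, eq_top_iff,
    ← Submodule.sup_orthogonal_of_hasOrthogonalProjection (K := ⨆ i, D i)]
  exact sup_le (iSup_le fun i e he => h i e he) fun e he => h0 e he

/-- The eigenspaces for nonzero eigenvalues of a symmetric operator which is given by distinct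
scalars on a family of subspaces and by zero on their common orthogonal complement. -/
theorem eigenspace_eq_of_family {T : E →ₗ[ℂ] E} (hT : T.IsSymmetric) {D : ι → Submodule ℂ E}
    {lam : ι → ℝ} (hinj : Function.Injective lam) (hne : ∀ i, lam i ≠ 0)
    (hD : ∀ i, ∀ e ∈ D i, T e = (lam i : ℂ) • e) (h0 : ∀ e ∈ (⨆ i, D i)ᗮ, T e = 0) (i : ι) :
    Module.End.eigenspace T (lam i : ℂ) = D i := by
  have hDe : ∀ j, ∀ e ∈ D j, e ∈ Module.End.eigenspace T (lam j : ℂ) := fun j e he =>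
    Module.End.mem_eigenspace_iff.2 (hD j e he)
  refine le_antisymm (fun v hv => ?_) (hDe i)
  -- The error `w` is an eigenvector for `lam i` or zero, yet it is orthogonal to all `D j`, so `T w
  -- = 0`; since `lam i ≠ 0`, it vanishes.
  set w := v - (D i).starProjection v with hw
  have hwe : w ∈ Module.End.eigenspace T (lam i : ℂ) :=
    sub_mem hv (hDe i _ (Submodule.starProjection_apply_mem _ _))
  have hw0 : T w = 0 := by
    refine h0 _ (orthogonal_le_of_isOrtho_family fun j e he => ?_)
    by_cases hij : j = i
    · subst hij
      exact (Submodule.mem_orthogonal _ _).1 (Submodule.sub_starProjection_mem_orthogonal v) e he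
    · exact inner_eq_zero_of_eigenspace hT
        (fun h => hij (hinj (Complex.ofReal_injective h))) (hDe j e he) hwe
  rw [Module.End.mem_eigenspace_iff, hw0] at hwe
  have : w = 0 := (smul_eq_zero.1 hwe.symm).resolve_left (by exact_mod_cast hne i)
  rw [hw, sub_eq_zero] at this
  rw [this]
  exact Submodule.starProjection_apply_mem _ _

/-- A strictly decreasing chain of nonzero subspaces is given by the partial sums of a family of
nonzero pairwise orthogonal subspaces. -/
theorem exists_orthogonal_family_of_strictAnti {k : ℕ} {G : Fin (k + 1) → Submodule ℂ E}
    (hG : StrictAnti G) (hne : ∀ i, G i ≠ ⊥) :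
    ∃ D : Fin (k + 1) → Submodule ℂ E, (∀ i, D i ≠ ⊥) ∧ (∀ i j, i ≠ j → D i ⟂ D j) ∧
      ∀ r, G r = ⨆ i, ⨆ _ : r ≤ i, D i := by
  -- `N i` is the next term of the chain, and `⊥` when `i` is last; the supremum treats both cases
  -- at once. `D i` is its orthogonal complement inside `G i`.
  let N : Fin (k + 1) → Submodule ℂ E := fun i => ⨆ j, ⨆ _ : i < j, G j
  have hN : ∀ i, N i ≤ G i := fun i => iSup₂_le fun j hj => (hG hj).le
  let D : Fin (k + 1) → Submodule ℂ E := fun i => (N i)ᗮ ⊓ G i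
  have hsup : ∀ i, N i ⊔ D i = G i := fun i =>
    Submodule.sup_orthogonal_inf_of_hasOrthogonalProjection (hN i)
  have hlt : ∀ i j, i < j → D i ⟂ D j := by
    intro i j hij
    have h1 : D j ≤ N i := inf_le_right.trans (le_iSup₂_of_le j hij le_rfl)
    exact ((Submodule.isOrtho_orthogonal_right (N i)).mono h1 inf_le_left).symm
  refine ⟨D, fun i hi => ?_, fun i j hij => ?_, ?_⟩
  · have hNi : N i = G i := by simpa [hi] using hsup i
    rcases Fin.eq_castSucc_or_eq_last i with ⟨j, rfl⟩ | rfl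
    · have : N j.castSucc ≤ G j.succ :=
        iSup₂_le fun l hl => hG.antitone (Fin.castSucc_lt_iff_succ_le.1 hl)
      exact absurd (hNi ▸ this) (hG j.castSucc_lt_succ).not_ge
    · refine hne (Fin.last k) ?_
      rw [← hNi, eq_bot_iff]
      exact iSup₂_le fun l hl => absurd (Fin.le_last l) hl.not_ge
  · rcases lt_or_gt_of_ne hij with h | h
    · exact hlt i j h
    · exact (hlt j i h).symm
  · intro r
    refine le_antisymm ?_ (iSup₂_le fun i hi => inf_le_right.trans (hG.antitone hi))
    induction r using WellFoundedGT.induction with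
    | ind r ih =>
      rw [← hsup r]
      refine sup_le (iSup₂_le fun j hj => (ih j hj).trans ?_) (le_iSup₂_of_le r le_rfl le_rfl)
      exact iSup₂_le fun i hi => le_iSup₂_of_le i (hj.le.trans hi) le_rfl

/-- The positive square root acts on an eigenvector by the square root of the eigenvalue. -/
theorem sqrt_apply_of_eigenvector {S : E →L[ℂ] E} (hS : 0 ≤ S) {t : ℝ} (ht : 0 ≤ t) {e : E}
    (he : S e = (t : ℂ) • e) : CFC.sqrt S e = ((√t : ℝ) : ℂ) • e := by
  set R := CFC.sqrt S with hR
  have hRR : ∀ v, R (R v) = S v := fun v => by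
    rw [← mul_apply_eq_comp, hR, CFC.sqrt_mul_sqrt_self S hS]
  have hpos : R.IsPositive := (ContinuousLinearMap.nonneg_iff_isPositive R).1 (CFC.sqrt_nonneg S)
  -- For `t > 0` the defect `d = R e - √t e` satisfies `R d = -√t d`, which positivity of `R` allows
  -- only for `d = 0`. For `t = 0` this carries no information, and `‖R e‖² = ⟪e, S e⟫ = 0` is used
  -- instead.
  rcases ht.eq_or_lt with rfl | ht'
  · have h0 : ⟪R e, R e⟫_ℂ = 0 := by
      refine (hpos.isSymmetric e (R e)).trans ?_
      simp [hRR, he]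
    simpa using h0
  set d := R e - ((√t : ℝ) : ℂ) • e with hd
  have hRd : R d = -(((√t : ℝ) : ℂ) • d) := by
    rw [hd, map_sub, map_smul, hRR, he, smul_sub, smul_smul, ← Complex.ofReal_mul,
      Real.mul_self_sqrt ht]
    abel
  have h1 : 0 ≤ RCLike.re ⟪R d, d⟫_ℂ := hpos.re_inner_nonneg_left d
  rw [hRd, inner_neg_left, inner_smul_left, Complex.conj_ofReal] at h1
  have h2 : RCLike.re (-(((√t : ℝ) : ℂ) * ⟪d, d⟫_ℂ)) = -(√t * ‖d‖ ^ 2) := by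
    rw [inner_self_eq_norm_sq_to_K, ← RCLike.ofReal_pow]
    simp [-Complex.ofReal_pow]
  rw [h2] at h1
  have h3 : ‖d‖ ^ 2 = 0 := by
    have := Real.sqrt_pos.2 ht'
    nlinarith [sq_nonneg ‖d‖]
  rw [← sub_eq_zero]
  exact norm_eq_zero.1 (pow_eq_zero_iff two_ne_zero |>.1 h3)

end LinearAlgebra

/-! ### The weighted sum of projections onto a chain. -/

section ChainOperator

variable {m k l : ℕ}

/-- The positive operator `∑ pᵢ P_{G i}` attached to a chain of subspaces and weights. -/
def chainOperator (G : Fin (k + 1) → NonzeroSubspace m) (p : Fin (k + 1) → ℝ) :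
    Cn m →L[ℂ] Cn m :=
  ∑ i, (p i : ℂ) • (G i).1.starProjection

theorem chainOperator_apply (G : Fin (k + 1) → NonzeroSubspace m) (p : Fin (k + 1) → ℝ)
    (v : Cn m) : chainOperator G p v = ∑ i, (p i : ℂ) • (G i).1.starProjection v := by
  simp [chainOperator]

theorem chainOperator_nonneg (G : Fin (k + 1) → NonzeroSubspace m)
    (p : stdSimplex ℝ (Fin (k + 1))) : 0 ≤ chainOperator G p := by
  refine Finset.sum_nonneg fun i _ => ?_
  rw [ContinuousLinearMap.nonneg_iff_isPositive]
  refine ContinuousLinearMap.IsPositive.smul_of_nonneg ?_ (by exact_mod_cast p.2.1 i)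
  exact ContinuousLinearMap.IsPositive.of_isStarProjection isStarProjection_starProjection

/-- Grouping the terms by the fibres of `θ` turns the sum of weights over a fibre into the
pushed-forward weight. This is why the construction descends to the realisation. -/
theorem chainOperator_comp (G : Fin (k + 1) → NonzeroSubspace m) (θ : Fin (l + 1) → Fin (k + 1))
    (p : stdSimplex ℝ (Fin (l + 1))) :
    chainOperator (G ∘ θ) p = chainOperator G (stdSimplex.map θ p) := by
  classical
  ext1 v
  simp only [chainOperator_apply, stdSimplex.map_coe, FunOnFinite.linearMap_apply_apply,
    Complex.ofReal_sum, Finset.sum_smul, Function.comp]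
  rw [← Finset.sum_fiberwise (s := Finset.univ) (g := θ)]
  refine Finset.sum_congr rfl fun i _ => Finset.sum_congr rfl fun j hj => ?_
  obtain rfl := (Finset.mem_filter.1 hj).2
  rfl

/-- A vector of `D i` lies in `G r` for `r ≤ i` and is orthogonal to `G r` for `r > i`, so exactly
the first weights up to `i` contribute. -/
theorem chainOperator_apply_of_mem {G : Fin (k + 1) → NonzeroSubspace m} {p : Fin (k + 1) → ℝ}
    {D : Fin (k + 1) → Submodule ℂ (Cn m)} (hD : ∀ i j, i ≠ j → D i ⟂ D j)
    (hG : ∀ r, (G r).1 = ⨆ i, ⨆ _ : r ≤ i, D i) {i : Fin (k + 1)} {e : Cn m} (he : e ∈ D i) :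
    chainOperator G p e = ((∑ r ∈ Finset.Iic i, p r : ℝ) : ℂ) • e := by
  rw [chainOperator_apply, Complex.ofReal_sum, Finset.sum_smul,
    ← Finset.sum_subset (Finset.subset_univ (Finset.Iic i))]
  · refine Finset.sum_congr rfl fun r hr => ?_
    rw [Submodule.starProjection_eq_self_iff.2]
    rw [hG]
    exact (le_iSup₂_of_le (f := fun j (_ : r ≤ j) => D j) i (Finset.mem_Iic.1 hr) le_rfl) he
  · intro r _ hr
    rw [(Submodule.starProjection_apply_eq_zero_iff _).2, smul_zero]
    rw [hG]
    exact (isOrtho_iSup_of_notMem hD (not_le.1 fun h => hr (Finset.mem_Iic.2 h))) he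

theorem chainOperator_apply_of_orthogonal {G : Fin (k + 1) → NonzeroSubspace m}
    (hG : Antitone G) (p : Fin (k + 1) → ℝ) {e : Cn m} (he : e ∈ (G 0).1ᗮ) :
    chainOperator G p e = 0 := by
  rw [chainOperator_apply]
  refine Finset.sum_eq_zero fun r _ => ?_
  rw [(Submodule.starProjection_apply_eq_zero_iff _).2, smul_zero]
  exact Submodule.orthogonal_le (hG (Fin.zero_le r)) he

theorem chainOperator_apply_last {G : Fin (k + 1) → NonzeroSubspace m} (hG : Antitone G)
    (p : stdSimplex ℝ (Fin (k + 1))) {e : Cn m} (he : e ∈ (G (Fin.last k)).1) :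
    chainOperator G p e = e := by
  rw [chainOperator_apply]
  have : ∀ r, (G r).1.starProjection e = e := fun r =>
    Submodule.starProjection_eq_self_iff.2 (hG (Fin.le_last r) he)
  simp only [this]
  rw [← Finset.sum_smul, ← Complex.ofReal_sum, stdSimplex.sum_eq_one]
  simp

end ChainOperator

section

variable {V V' : Type u} {W W' : Type v}
  [NormedAddCommGroup V] [InnerProductSpace ℂ V]
  [NormedAddCommGroup V'] [InnerProductSpace ℂ V']
  [NormedAddCommGroup W] [InnerProductSpace ℂ W]
  [NormedAddCommGroup W'] [InnerProductSpace ℂ W']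

/-! ### A simplex as a chain, a partial isometry on `ℂ^m` and an isometry on `V`. -/

namespace BarSimplex

variable {m k l : ℕ}

theorem zLeft_apply (b : BarSimplex V W m k) (c : Cn m) :
    b.zLeft c = b.z (WithLp.toLp 2 ((b.chain 0).1.orthogonalProjectionOnto c, 0)) := rfl

theorem zLeft_apply_of_mem (b : BarSimplex V W m k) (c : (b.chain 0).1) :
    b.zLeft c = b.z (WithLp.toLp 2 (c, 0)) := by
  rw [zLeft_apply, Submodule.orthogonalProjectionOnto_mem_subspace_eq_self]

theorem zLeft_apply_of_orthogonal (b : BarSimplex V W m k) {c : Cn m}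
    (hc : c ∈ (b.chain 0).1ᗮ) : b.zLeft c = 0 := by
  rw [zLeft_apply, Submodule.orthogonalProjectionOnto_apply_of_mem_orthogonal hc]
  exact map_zero b.z

theorem zRight_apply (b : BarSimplex V W m k) (v : V) :
    b.zRight v = b.z (WithLp.toLp 2 (0, v)) := rfl

theorem z_apply (b : BarSimplex V W m k) (c : (b.chain 0).1) (v : V) :
    b.z (WithLp.toLp 2 (c, v)) = b.zLeft c + b.zRight v := by
  rw [zLeft_apply_of_mem, zRight_apply, ← map_add, ← WithLp.toLp_add, Prod.mk_add_mk, add_zero,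
    zero_add]

/-- This says that `zLeft` is a partial isometry with initial space `G 0`. -/
theorem inner_zLeft_zLeft (b : BarSimplex V W m k) (c d : Cn m) :
    ⟪b.zLeft c, b.zLeft d⟫_ℂ = ⟪c, (b.chain 0).1.starProjection d⟫_ℂ := by
  rw [zLeft_apply, zLeft_apply]
  refine (LinearIsometry.inner_map_map (𝕜 := ℂ) (E := WithLp 2 ((b.chain 0).1 × V)) (E' := W)
    b.z _ _).trans ?_
  rw [WithLp.prod_inner_apply]
  simp
  exact Submodule.inner_starProjection_left_eq_right _ _ _

theorem inner_zRight_zLeft (b : BarSimplex V W m k) (v : V) (c : Cn m) :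
    ⟪b.zRight v, b.zLeft c⟫_ℂ = 0 := by
  rw [zLeft_apply, zRight_apply]
  refine (LinearIsometry.inner_map_map (𝕜 := ℂ) (E := WithLp 2 ((b.chain 0).1 × V)) (E' := W)
    b.z _ _).trans ?_
  rw [WithLp.prod_inner_apply]
  simp

/-- The type of `z` depends on the chain; `zLeft` and `zRight` have fixed types, so no transport is
needed to compare simplices. -/
theorem ext_maps {b b' : BarSimplex V W m k} (hc : b.chain = b'.chain)
    (hl : ∀ c, b.zLeft c = b'.zLeft c) (hr : ∀ v, b.zRight v = b'.zRight v) : b = b' := by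
  have key : ∀ (c : Cn m) (h : c ∈ (b.chain 0).1) (h' : c ∈ (b'.chain 0).1) (v : V),
      b.z (WithLp.toLp 2 (⟨c, h⟩, v)) = b'.z (WithLp.toLp 2 (⟨c, h'⟩, v)) := by
    intro c h h' v
    rw [z_apply, z_apply, hl, hr]
  obtain ⟨G, hG, z⟩ := b
  obtain ⟨G', hG', z'⟩ := b'
  obtain rfl : G = G' := hc
  congr 1
  ext x
  exact key x.fst.1 x.fst.2 x.fst.2 x.snd

/-- A simplex from a chain, a map on `ℂ^m` and an isometry on `V`. -/
def ofMaps (G : Fin (k + 1) → NonzeroSubspace m) (hG : Antitone G) (A : Cn m →ₗ[ℂ] W)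
    (B : V →ₗᵢ[ℂ] W) (hA : ∀ c ∈ (G 0).1, ‖A c‖ = ‖c‖)
    (hBA : ∀ c ∈ (G 0).1, ∀ v, ⟪B v, A c⟫_ℂ = 0) : BarSimplex V W m k where
  chain := G
  antitone := hG
  z :=
    { toFun := fun x => A x.fst.1 + B x.snd
      map_add' := fun x y => by
        simp only [WithLp.add_fst, WithLp.add_snd, Submodule.coe_add, map_add]
        abel
      map_smul' := fun a x => by
        simp only [WithLp.smul_fst, WithLp.smul_snd, Submodule.coe_smul, map_smul, smul_add,
          RingHom.id_apply]
      norm_map' := fun x => by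
        have h0 : ⟪A x.fst.1, B x.snd⟫_ℂ = 0 :=
          inner_eq_zero_symm.1 (hBA _ x.fst.2 _)
        refine (sq_eq_sq₀ (norm_nonneg _) (norm_nonneg _)).1 ?_
        rw [WithLp.prod_norm_sq_eq_of_L2]
        have := norm_add_sq_eq_norm_sq_add_norm_sq_of_inner_eq_zero _ _ h0
        simp only [hA _ x.fst.2, B.norm_map, ← sq] at this
        exact this }

theorem ofMaps_zRight (G : Fin (k + 1) → NonzeroSubspace m) (hG : Antitone G)
    (A : Cn m →ₗ[ℂ] W) (B : V →ₗᵢ[ℂ] W) (hA : ∀ c ∈ (G 0).1, ‖A c‖ = ‖c‖)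
    (hBA : ∀ c ∈ (G 0).1, ∀ v, ⟪B v, A c⟫_ℂ = 0) (v : V) :
    (ofMaps G hG A B hA hBA).zRight v = B v := by
  change A 0 + B v = B v
  rw [map_zero, zero_add]

theorem ofMaps_zLeft (G : Fin (k + 1) → NonzeroSubspace m) (hG : Antitone G)
    (A : Cn m →ₗ[ℂ] W) (B : V →ₗᵢ[ℂ] W) (hA : ∀ c ∈ (G 0).1, ‖A c‖ = ‖c‖)
    (hBA : ∀ c ∈ (G 0).1, ∀ v, ⟪B v, A c⟫_ℂ = 0) (c : Cn m) :
    (ofMaps G hG A B hA hBA).zLeft c = A ((G 0).1.starProjection c) := by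
  change A ((G 0).1.starProjection c) + B 0 = _
  rw [map_zero, add_zero]

theorem pull_zRight (θ : Fin (l + 1) →o Fin (k + 1)) (b : BarSimplex V W m k) (v : V) :
    (b.pull θ).zRight v = b.zRight v := by
  change b.z (WithLp.toLp 2 (inclusionIsometry (b.antitone (Fin.zero_le (θ 0))) 0, v)) = _
  rw [map_zero, zRight_apply]

theorem pull_zLeft (θ : Fin (l + 1) →o Fin (k + 1)) (b : BarSimplex V W m k) (c : Cn m) :
    (b.pull θ).zLeft c = b.zLeft ((b.chain (θ 0)).1.starProjection c) := by
  have h : (b.chain (θ 0)).1 ≤ (b.chain 0).1 := b.antitone (Fin.zero_le (θ 0))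
  exact (zLeft_apply_of_mem b ⟨(b.chain (θ 0)).1.starProjection c,
    h (Submodule.starProjection_apply_mem _ _)⟩).symm

theorem map_zRight (g : V' →ₗᵢ[ℂ] V) (h : W →ₗᵢ[ℂ] W') (b : BarSimplex V W m k) (v : V') :
    (b.map g h).zRight v = h (b.zRight (g v)) := rfl

theorem map_zLeft (g : V' →ₗᵢ[ℂ] V) (h : W →ₗᵢ[ℂ] W') (b : BarSimplex V W m k) (c : Cn m) :
    (b.map g h).zLeft c = h (b.zLeft c) := by
  change h (b.z (WithLp.toLp 2 ((b.chain 0).1.orthogonalProjectionOnto c, g 0))) = _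
  rw [map_zero, zLeft_apply]

/-! ### Compactness -/

theorem isInducing_maps : Topology.IsInducing
    (fun b : BarSimplex V W m k => (b.chain, b.zLeft, b.zRight.toContinuousLinearMap)) := ⟨rfl⟩

end BarSimplex

theorem isInducing_starProjection {m : ℕ} : Topology.IsInducing
    (fun U : NonzeroSubspace m => (U.1.starProjection : Cn m →L[ℂ] Cn m)) := ⟨rfl⟩

/-- A nonzero orthogonal projection has norm exactly one, so excluding `⊥` is a closed condition and
the image is a closed subset of the unit ball. -/
instance {m : ℕ} : CompactSpace (NonzeroSubspace m) := by
  rw [← isCompact_univ_iff, isInducing_starProjection.isCompact_iff, Set.image_univ]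
  have : ProperSpace (Cn m →L[ℂ] Cn m) := FiniteDimensional.proper ℂ _
  have : Set.range (fun U : NonzeroSubspace m => (U.1.starProjection : Cn m →L[ℂ] Cn m)) =
      {P | P * P = P ∧ star P = P ∧ ‖P‖ = 1} := by
    ext P
    constructor
    · rintro ⟨U, rfl⟩
      exact ⟨isStarProjection_starProjection.isIdempotentElem,
        isStarProjection_starProjection.isSelfAdjoint, U.1.norm_starProjection U.2⟩
    · rintro ⟨h1, h2, h3⟩
      have hP := isStarProjection_iff_eq_starProjection_range.1
        (⟨h1, h2⟩ : IsStarProjection P)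
      obtain ⟨hh, hP⟩ := hP
      refine ⟨⟨P.range, fun h => ?_⟩, hP.symm⟩
      have : P = 0 := by
        ext1 v
        have : P v ∈ P.range := ⟨v, rfl⟩
        rw [h] at this
        simpa using this
      rw [this, norm_zero] at h3
      exact zero_ne_one h3
  rw [this]
  refine (isCompact_closedBall (0 : Cn m →L[ℂ] Cn m) 1).of_isClosed_subset ?_ ?_
  · exact (isClosed_eq (by fun_prop) (by fun_prop)).inter
      ((isClosed_eq (by fun_prop) (by fun_prop)).inter (isClosed_eq (by fun_prop) (by fun_prop)))
  · rintro P ⟨-, -, h⟩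
    simp [h]

theorem le_iff_starProjection_comp {m : ℕ} (U U' : Submodule ℂ (Cn m)) :
    U ≤ U' ↔ U'.starProjection * U.starProjection = U.starProjection := by
  constructor
  · intro h
    ext1 v
    exact Submodule.starProjection_eq_self_iff.2 (h (Submodule.starProjection_apply_mem _ _))
  · intro h v hv
    rw [← Submodule.starProjection_eq_self_iff (K := U')]
    have := congrArg (fun A : Cn m →L[ℂ] Cn m => A v) h
    simpa [Submodule.starProjection_eq_self_iff.2 hv] using this

/-- The defining map embeds the simplices as a closed subset of chains times two unit balls:
nesting, isometry and orthogonality are all equations in the projections and the two maps. -/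
instance {m k : ℕ} [FiniteDimensional ℂ V] [FiniteDimensional ℂ W] :
    CompactSpace (BarSimplex V W m k) := by
  rw [← isCompact_univ_iff, BarSimplex.isInducing_maps.isCompact_iff, Set.image_univ]
  have : ProperSpace (Cn m →L[ℂ] W) := FiniteDimensional.proper ℂ _
  have : ProperSpace (V →L[ℂ] W) := FiniteDimensional.proper ℂ _
  let P : Fin (k + 1) → (Fin (k + 1) → NonzeroSubspace m) × (Cn m →L[ℂ] W) × (V →L[ℂ] W) →
    (Cn m →L[ℂ] Cn m) := fun i x => (x.1 i).1.starProjection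
  have hP : ∀ i, Continuous (P i) := fun i =>
    isInducing_starProjection.continuous.comp ((continuous_apply i).comp continuous_fst)
  have : Set.range (fun b : BarSimplex V W m k =>
      (b.chain, b.zLeft, b.zRight.toContinuousLinearMap)) =
      {x | (∀ i j, i ≤ j → P i x * P j x = P j x) ∧ (∀ c, ‖x.2.1 c‖ = ‖P 0 x c‖) ∧
        (∀ v, ‖x.2.2 v‖ = ‖v‖) ∧ ∀ v c, ⟪x.2.2 v, x.2.1 c⟫_ℂ = 0} := by
    ext ⟨G, A, B⟩
    constructor
    · rintro ⟨b, hb⟩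
      obtain ⟨rfl, rfl, rfl⟩ : b.chain = G ∧ b.zLeft = A ∧ b.zRight.toContinuousLinearMap = B := by
        simpa using hb
      refine ⟨fun i j hij => (le_iff_starProjection_comp _ _).1 (b.antitone hij), fun c => ?_,
        b.zRight.norm_map, b.inner_zRight_zLeft⟩
      refine (b.z.norm_map _).trans ?_
      simp [P]
    · rintro ⟨h1, h2, h3, h4⟩
      have hG : Antitone G := fun i j hij => (le_iff_starProjection_comp _ _).2 (h1 i j hij)
      refine ⟨BarSimplex.ofMaps G hG A.toLinearMap ⟨B.toLinearMap, h3⟩ (fun c hc => ?_)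
        fun c _ v => h4 v c, ?_⟩
      · refine (h2 c).trans ?_
        simp only [P, Submodule.starProjection_eq_self_iff.2 hc]
      · refine Prod.ext rfl (Prod.ext ?_ ?_)
        · ext1 c
          refine (BarSimplex.ofMaps_zLeft ..).trans ?_
          -- The norm equation, applied to a vector orthogonal to `G 0`, shows that `A` vanishes
          -- there, so `A` is recovered from its restriction to `G 0`.
          have := h2 (c - (G 0).1.starProjection c)
          have h0 : P 0 (G, A, B) (c - (G 0).1.starProjection c) = 0 :=
            (Submodule.starProjection_apply_eq_zero_iff _).2
              (Submodule.sub_starProjection_mem_orthogonal c)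
          rw [h0, norm_zero, norm_eq_zero, map_sub, sub_eq_zero] at this
          exact this.symm
        · ext1 v
          exact BarSimplex.ofMaps_zRight ..
  rw [this]
  refine (isCompact_univ.prod ((isCompact_closedBall (0 : Cn m →L[ℂ] W) 1).prod
    (isCompact_closedBall (0 : V →L[ℂ] W) 1))).of_isClosed_subset ?_ ?_
  · simp only [Set.ofPred_and, Set.ofPred_forall]
    have hA : ∀ c, Continuous fun x : (Fin (k + 1) → NonzeroSubspace m) × (Cn m →L[ℂ] W) ×
      (V →L[ℂ] W) => x.2.1 c := fun c => by fun_prop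
    have hB : ∀ c, Continuous fun x : (Fin (k + 1) → NonzeroSubspace m) × (Cn m →L[ℂ] W) ×
      (V →L[ℂ] W) => x.2.2 c := fun c => by fun_prop
    refine IsClosed.inter ?_ (IsClosed.inter ?_ (IsClosed.inter ?_ ?_))
    · exact isClosed_iInter fun i => isClosed_iInter fun j => isClosed_iInter fun _ =>
        isClosed_eq ((hP i).mul (hP j)) (hP j)
    · exact isClosed_iInter fun c => isClosed_eq (hA c).norm ((hP 0).clm_apply continuous_const).norm
    · exact isClosed_iInter fun v => isClosed_eq (hB v).norm continuous_const
    · exact isClosed_iInter fun v => isClosed_iInter fun c =>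
        isClosed_eq ((hB v).inner (hA c)) continuous_const
  · rintro ⟨G, A, B⟩ ⟨h1, h2, h3, h4⟩
    refine ⟨Set.mem_univ _, ?_, ?_⟩
    · rw [mem_closedBall_zero_iff]
      refine ContinuousLinearMap.opNorm_le_bound _ zero_le_one fun c => ?_
      rw [one_mul]
      exact (h2 c).trans_le (Submodule.norm_starProjection_apply_le _ _)
    · rw [mem_closedBall_zero_iff]
      exact ContinuousLinearMap.opNorm_le_bound _ zero_le_one fun v => by
        rw [one_mul]; exact (h3 v).le

end

/-! ### Tensors and linear maps -/

section

variable {m : ℕ} {E : Type v} [AddCommGroup E] [Module ℂ E]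

theorem tensorToHom_tmul (c : Cn m) (w : E) (v : Cn m) :
    tensorToHom m E (c ⊗ₜ w) v = (∑ j, c j * v j) • w := by
  have h : (EuclideanSpace.basisFun (Fin m) ℂ).toBasis.toDual c v = ∑ j, c j * v j := by
    conv_lhs => rw [← (EuclideanSpace.basisFun (Fin m) ℂ).toBasis.sum_repr v]
    simp only [map_sum, map_smul, Module.Basis.toDual_apply_left]
    simp [mul_comm]
  simp only [tensorToHom, LinearMap.comp_apply, LinearMap.rTensor_tmul, dualTensorHom_apply, h]

/-- The tensor `∑ eⱼ ⊗ A eⱼ` which corresponds to the linear map `A`. -/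
def homToTensor (A : Cn m →ₗ[ℂ] E) : Cn m ⊗[ℂ] E :=
  ∑ j, EuclideanSpace.single j (1 : ℂ) ⊗ₜ A (EuclideanSpace.single j 1)

theorem tensorToHom_homToTensor (A : Cn m →ₗ[ℂ] E) : tensorToHom m E (homToTensor A) = A := by
  ext v
  conv_rhs => rw [← (EuclideanSpace.basisFun (Fin m) ℂ).sum_repr v]
  simp [homToTensor, tensorToHom_tmul]

theorem homToTensor_tensorToHom (x : Cn m ⊗[ℂ] E) : homToTensor (tensorToHom m E x) = x := by
  induction x with
  | zero => simp [homToTensor]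
  | add x y hx hy =>
    conv_rhs => rw [← hx, ← hy]
    simp [homToTensor, TensorProduct.tmul_add, Finset.sum_add_distrib]
  | tmul c w =>
    conv_rhs => rw [← (EuclideanSpace.basisFun (Fin m) ℂ).sum_repr c]
    simp [homToTensor, tensorToHom_tmul, TensorProduct.sum_tmul, TensorProduct.smul_tmul]

theorem tensorToHom_injective : Function.Injective (tensorToHom m E) :=
  Function.LeftInverse.injective homToTensor_tensorToHom

theorem tensorToHom_lTensor {F : Type*} [AddCommGroup F] [Module ℂ F] (h : E →ₗ[ℂ] F)
    (x : Cn m ⊗[ℂ] E) (v : Cn m) :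
    tensorToHom m F (LinearMap.lTensor (Cn m) h x) v = h (tensorToHom m E x v) := by
  induction x with
  | zero => simp
  | add x y hx hy => simp [hx, hy]
  | tmul c w => simp [tensorToHom_tmul]

theorem lTensor_homToTensor {F : Type*} [AddCommGroup F] [Module ℂ F] (h : E →ₗ[ℂ] F)
    (A : Cn m →ₗ[ℂ] E) :
    LinearMap.lTensor (Cn m) h (homToTensor A) =
      ∑ j, EuclideanSpace.single j (1 : ℂ) ⊗ₜ[ℂ] h (A (EuclideanSpace.single j 1)) := by
  simp [homToTensor]

end

section

variable {V V' : Type u} {W W' : Type v}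
  [NormedAddCommGroup V] [InnerProductSpace ℂ V]
  [NormedAddCommGroup V'] [InnerProductSpace ℂ V']
  [NormedAddCommGroup W] [InnerProductSpace ℂ W]
  [NormedAddCommGroup W'] [InnerProductSpace ℂ W']
  {m k l : ℕ}

/-! ### The sphere bundle -/

theorem norm_smul_tensor {E : Type*} [NormedAddCommGroup E] [InnerProductSpace ℂ E] (c : ℂ)
    (x : Cn m ⊗[ℂ] E) : ‖c • x‖ = ‖c‖ * ‖x‖ := norm_smul c x

theorem norm_lTensor_subtype (K : Submodule ℂ W) (x : Cn m ⊗[ℂ] K) :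
    ‖LinearMap.lTensor (Cn m) K.subtype x‖ = ‖x‖ :=
  (LinearIsometry.lTensor (Cn m) K.subtypeₗᵢ).norm_map x

instance : T2Space (ComplementBundle V W m) := by
  refine T2Space.of_injective_continuous (f := fun q : ComplementBundle V W m =>
    (q.f.toContinuousLinearMap,
      LinearMap.lTensor (Cn m) (LinearMap.range q.f.toLinearMap)ᗮ.subtype q.x)) ?_
    continuous_induced_dom
  rintro ⟨f, x⟩ ⟨f', x'⟩ h
  obtain ⟨h1, h2⟩ := Prod.mk.inj h
  obtain rfl : f = f' := by
    ext v
    exact congrArg (fun A : V →L[ℂ] W => A v) h1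
  obtain rfl : x = x' :=
    (LinearIsometry.lTensor (Cn m) (LinearMap.range f.toLinearMap)ᗮ.subtypeₗᵢ).injective h2
  rfl

/-- Both tensors have norm one, so a positive factor between them must be one. Later comparisons can
therefore ignore the normalising constant. -/
theorem SphereBundle.ext_of_smul [FiniteDimensional ℂ W] {s t : SphereBundle V W m}
    (hf : ∀ v, s.1.f v = t.1.f v) {c : ℝ} (hc : 0 < c)
    (hx : ∀ v, (s.1.hom v : W) = (c : ℂ) • (t.1.hom v : W)) : s = t := by
  obtain ⟨⟨f, x⟩, hs⟩ := s
  obtain ⟨⟨f', x'⟩, ht⟩ := t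
  obtain rfl : f = f' := LinearIsometry.ext hf
  have h : x = (c : ℂ) • x' := by
    apply tensorToHom_injective
    ext v
    rw [map_smul]
    exact hx v
  have hc1 : c = 1 := by
    dsimp only at hs ht
    rw [h, norm_smul_tensor, ht, mul_one, Complex.norm_real, Real.norm_of_nonneg hc.le] at hs
    exact hs
  obtain rfl : x = x' := by rw [h, hc1, Complex.ofReal_one, one_smul]
  rfl

theorem SphereBundle.exists_hom_ne_zero (s : SphereBundle V W m) : ∃ v, s.1.hom v ≠ 0 := by
  by_contra! h
  have h0 : s.1.x = 0 := tensorToHom_injective (by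
    rw [map_zero]
    exact LinearMap.ext h)
  have := s.2
  rw [h0] at this
  exact zero_ne_one ((norm_zero
    (E := Cn m ⊗[ℂ] ↥((LinearMap.range s.1.f.toLinearMap)ᗮ))).symm.trans this)

theorem SphereBundle.map_hom [FiniteDimensional ℂ W] [FiniteDimensional ℂ W'] (g : V' →ₗᵢ[ℂ] V)
    (h : W →ₗᵢ[ℂ] W') (s : SphereBundle V W m) (v : Cn m) :
    ((SphereBundle.map g h s).1.hom v : W') = h (s.1.hom v : W) :=
  congrArg Subtype.val (tensorToHom_lTensor (complementMap s.1.f g h).toLinearMap s.1.x v)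

theorem ComplementBundle.inner_gram [FiniteDimensional ℂ W] (q : ComplementBundle V W m)
    (u v : Cn m) : ⟪q.gram u, v⟫_ℂ = ⟪(q.hom u : W), (q.hom v : W)⟫_ℂ := by
  rw [gram, LinearMap.comp_apply, LinearMap.adjoint_inner_left]
  rfl

theorem ComplementBundle.gram_isSymmetric [FiniteDimensional ℂ W] (q : ComplementBundle V W m) :
    q.gram.IsSymmetric := fun u v => by
  rw [q.inner_gram, ← inner_conj_symm u, q.inner_gram, inner_conj_symm]

/-! ### The map on simplices -/

namespace BarSimplex

/-- The operator `zLeft ∘ S^{1/2}`, where `S = ∑ pᵢ P_{G i}`. -/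
def polar (b : BarSimplex V W m k) (p : stdSimplex ℝ (Fin (k + 1))) : Cn m →L[ℂ] W :=
  b.zLeft ∘L CFC.sqrt (chainOperator b.chain p)

theorem polar_apply_of_eigenvector (b : BarSimplex V W m k) (p : stdSimplex ℝ (Fin (k + 1)))
    {t : ℝ} (ht : 0 ≤ t) {e : Cn m} (he : chainOperator b.chain p e = (t : ℂ) • e) :
    b.polar p e = ((√t : ℝ) : ℂ) • b.zLeft e := by
  rw [polar, ContinuousLinearMap.comp_apply,
    sqrt_apply_of_eigenvector (chainOperator_nonneg _ p) ht he, map_smul]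

theorem polar_apply_of_orthogonal (b : BarSimplex V W m k) (p : stdSimplex ℝ (Fin (k + 1)))
    {e : Cn m} (he : e ∈ (b.chain 0).1ᗮ) : b.polar p e = 0 := by
  rw [b.polar_apply_of_eigenvector p le_rfl
    (by rw [chainOperator_apply_of_orthogonal b.antitone _ he]; simp)]
  simp

/-- The square root is symmetric and kills the orthogonal complement of `G 0`, so its range lies in
the double complement. -/
theorem sqrt_chainOperator_mem {G : Fin (k + 1) → NonzeroSubspace m} (hG : Antitone G)
    (p : stdSimplex ℝ (Fin (k + 1))) (v : Cn m) :
    CFC.sqrt (chainOperator G p) v ∈ (G 0).1 := by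
  rw [← Submodule.orthogonal_orthogonal (G 0).1, Submodule.mem_orthogonal]
  intro e he
  have hpos := (ContinuousLinearMap.nonneg_iff_isPositive _).1
    (CFC.sqrt_nonneg (chainOperator G p))
  refine (hpos.isSymmetric e v).symm.trans ?_
  have : CFC.sqrt (chainOperator G p) e = 0 := by
    rw [sqrt_apply_of_eigenvector (chainOperator_nonneg _ p) le_rfl
      (by rw [chainOperator_apply_of_orthogonal hG _ he]; simp)]
    simp
  change ⟪CFC.sqrt (chainOperator G p) e, v⟫_ℂ = 0
  rw [this, inner_zero_left]

/-- Since `zLeft` is isometric on the range of `√S`, only `√S √S = S` remains. -/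
theorem inner_polar (b : BarSimplex V W m k) (p : stdSimplex ℝ (Fin (k + 1))) (u v : Cn m) :
    ⟪b.polar p u, b.polar p v⟫_ℂ = ⟪chainOperator b.chain p u, v⟫_ℂ := by
  have hpos := (ContinuousLinearMap.nonneg_iff_isPositive _).1
    (CFC.sqrt_nonneg (chainOperator b.chain p))
  rw [polar, ContinuousLinearMap.comp_apply, ContinuousLinearMap.comp_apply, inner_zLeft_zLeft,
    Submodule.starProjection_eq_self_iff.2 (sqrt_chainOperator_mem b.antitone p v)]
  refine (hpos.isSymmetric _ v).symm.trans ?_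
  change ⟪CFC.sqrt (chainOperator b.chain p) (CFC.sqrt (chainOperator b.chain p) u), v⟫_ℂ = _
  rw [← mul_apply_eq_comp, CFC.sqrt_mul_sqrt_self (chainOperator b.chain p) (chainOperator_nonneg _ p)]

theorem polar_mem (b : BarSimplex V W m k) (p : stdSimplex ℝ (Fin (k + 1))) (v : Cn m) :
    b.polar p v ∈ (LinearMap.range b.zRight.toLinearMap)ᗮ := by
  rw [Submodule.mem_orthogonal]
  rintro _ ⟨w, rfl⟩
  exact b.inner_zRight_zLeft _ _

/-- On the last term of the chain all projections are the identity and the weights sum to one, so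
`S` is the identity there. This makes the normalisation possible. -/
theorem polar_ne_zero (b : BarSimplex V W m k) (p : stdSimplex ℝ (Fin (k + 1))) :
    ∃ v, b.polar p v ≠ 0 := by
  obtain ⟨v, hv, hv0⟩ := Submodule.exists_mem_ne_zero_of_ne_bot (b.chain (Fin.last k)).2
  refine ⟨v, fun h => hv0 ?_⟩
  have := b.inner_polar p v v
  rw [h, inner_zero_left, chainOperator_apply_last b.antitone p hv] at this
  exact inner_self_eq_zero.1 this.symm

/-- Restriction to `G (θ 0)` inserts a projection, which is invisible because `√S` of the reindexed
chain already lands in `G (θ 0)`. -/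
theorem polar_pull (θ : Fin (l + 1) →o Fin (k + 1)) (b : BarSimplex V W m k)
    (p : stdSimplex ℝ (Fin (l + 1))) (v : Cn m) :
    (b.pull θ).polar p v = b.polar (stdSimplex.map θ p) v := by
  rw [polar, polar, ContinuousLinearMap.comp_apply, ContinuousLinearMap.comp_apply, pull_zLeft]
  have h := sqrt_chainOperator_mem (b.pull θ).antitone p v
  have hc : (b.pull θ).chain = b.chain ∘ θ := rfl
  rw [hc] at h ⊢
  rw [chainOperator_comp] at h ⊢
  exact congrArg b.zLeft (Submodule.starProjection_eq_self_iff.2 h)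

theorem polar_map (g : V' →ₗᵢ[ℂ] V) (h : W →ₗᵢ[ℂ] W') (b : BarSimplex V W m k)
    (p : stdSimplex ℝ (Fin (k + 1))) (v : Cn m) :
    (b.map g h).polar p v = h (b.polar p v) :=
  map_zLeft g h b _

/-- The tensor in `ℂ^m ⊗ (z V)^⊥` which corresponds to `zLeft ∘ S^{1/2}`. -/
def polarTensor (b : BarSimplex V W m k) (p : stdSimplex ℝ (Fin (k + 1))) :
    Cn m ⊗[ℂ] ↥((LinearMap.range b.zRight.toLinearMap)ᗮ) :=
  homToTensor ((b.polar p).toLinearMap.codRestrict _ (b.polar_mem p))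

theorem norm_polarTensor_pos (b : BarSimplex V W m k) (p : stdSimplex ℝ (Fin (k + 1))) :
    0 < ‖b.polarTensor p‖ := by
  rw [norm_pos_iff]
  intro h
  obtain ⟨v, hv⟩ := b.polar_ne_zero p
  have := congrArg (fun x => (tensorToHom m ↥((LinearMap.range b.zRight.toLinearMap)ᗮ) x v : W)) h
  simp only [polarTensor, tensorToHom_homToTensor] at this
  exact hv (by simpa using this)

/-- The point of the sphere bundle given by a simplex and barycentric coordinates. -/
def toSphere (b : BarSimplex V W m k) (p : stdSimplex ℝ (Fin (k + 1))) : SphereBundle V W m :=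
  ⟨{ f := b.zRight
     x := ((‖b.polarTensor p‖⁻¹ : ℝ) : ℂ) • b.polarTensor p }, by
    have := b.norm_polarTensor_pos p
    refine (norm_smul_tensor _ _).trans ?_
    rw [Complex.norm_real, Real.norm_of_nonneg (inv_nonneg.2 this.le), inv_mul_cancel₀ this.ne']⟩

theorem toSphere_hom [FiniteDimensional ℂ W] (b : BarSimplex V W m k)
    (p : stdSimplex ℝ (Fin (k + 1))) (v : Cn m) :
    ((b.toSphere p).1.hom v : W) = ((‖b.polarTensor p‖⁻¹ : ℝ) : ℂ) • b.polar p v := by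
  have : (b.toSphere p).1.hom = ((‖b.polarTensor p‖⁻¹ : ℝ) : ℂ) •
      (b.polar p).toLinearMap.codRestrict _ (b.polar_mem p) := by
    rw [← tensorToHom_homToTensor ((b.polar p).toLinearMap.codRestrict _ (b.polar_mem p))]
    exact map_smul (tensorToHom m _) _ (b.polarTensor p)
  rw [this]
  rfl

theorem toSphere_eq_of_smul [FiniteDimensional ℂ W] (b : BarSimplex V W m k)
    (p : stdSimplex ℝ (Fin (k + 1))) {s : SphereBundle V W m} (hf : ∀ v, b.zRight v = s.1.f v)
    {c : ℝ} (hc : 0 < c) (hx : ∀ v, b.polar p v = (c : ℂ) • (s.1.hom v : W)) :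
    b.toSphere p = s := by
  refine SphereBundle.ext_of_smul hf (mul_pos (inv_pos.2 (b.norm_polarTensor_pos p)) hc) ?_
  intro v
  rw [toSphere_hom, hx, smul_smul, Complex.ofReal_mul]

theorem toSphere_pull [FiniteDimensional ℂ W] (θ : Fin (l + 1) →o Fin (k + 1))
    (b : BarSimplex V W m k) (p : stdSimplex ℝ (Fin (l + 1))) :
    (b.pull θ).toSphere p = b.toSphere (stdSimplex.map θ p) := by
  refine toSphere_eq_of_smul _ _ (pull_zRight θ b)
    (b.norm_polarTensor_pos (stdSimplex.map θ p)) fun v => ?_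
  rw [toSphere_hom, smul_smul, ← Complex.ofReal_mul,
    mul_inv_cancel₀ (b.norm_polarTensor_pos _).ne', Complex.ofReal_one, one_smul, polar_pull]

theorem toSphere_map [FiniteDimensional ℂ W] [FiniteDimensional ℂ W'] (g : V' →ₗᵢ[ℂ] V)
    (h : W →ₗᵢ[ℂ] W') (b : BarSimplex V W m k) (p : stdSimplex ℝ (Fin (k + 1))) :
    (b.map g h).toSphere p = SphereBundle.map g h (b.toSphere p) := by
  refine toSphere_eq_of_smul _ _ (map_zRight g h b) (b.norm_polarTensor_pos p) fun v => ?_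
  rw [SphereBundle.map_hom, toSphere_hom, map_smul, smul_smul, ← Complex.ofReal_mul,
    mul_inv_cancel₀ (b.norm_polarTensor_pos _).ne', Complex.ofReal_one, one_smul, polar_map]

theorem toSphere_gram [FiniteDimensional ℂ W] (b : BarSimplex V W m k)
    (p : stdSimplex ℝ (Fin (k + 1))) (v : Cn m) :
    (b.toSphere p).1.gram v =
      ((‖b.polarTensor p‖⁻¹ ^ 2 : ℝ) : ℂ) • chainOperator b.chain p v := by
  refine ext_inner_right ℂ fun w => ?_
  rw [ComplementBundle.inner_gram, toSphere_hom, toSphere_hom, inner_smul_left, inner_smul_right,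
    inner_polar, inner_smul_left, Complex.conj_ofReal, Complex.conj_ofReal, ← mul_assoc, sq,
    Complex.ofReal_mul]

/-! ### Continuity -/

/-- The point is that the square root is continuous on nonnegative operators, even where eigenvalues
collide or vanish. -/
theorem continuous_polar : Continuous
    (fun a : BarSimplex V W m k × stdSimplex ℝ (Fin (k + 1)) => a.1.polar a.2) := by
  have hmaps := (isInducing_maps (V := V) (W := W) (m := m) (k := k)).continuous.comp
    (continuous_fst (Y := stdSimplex ℝ (Fin (k + 1))))
  have hS : Continuous (fun a : BarSimplex V W m k × stdSimplex ℝ (Fin (k + 1)) =>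
      chainOperator a.1.chain a.2) := by
    refine continuous_finsetSum _ fun i _ => Continuous.fun_smul ?_ ?_
    · exact Complex.continuous_ofReal.comp
        ((continuous_apply i).comp (continuous_subtype_val.comp continuous_snd))
    · exact isInducing_starProjection.continuous.comp
        ((continuous_apply i).comp (continuous_fst.comp hmaps))
  refine Continuous.clm_comp (continuous_fst.comp (continuous_snd.comp hmaps)) ?_
  exact CFC.continuousOn_sqrt.comp_continuous hS fun a => chainOperator_nonneg _ a.2

theorem continuous_toSphere : Continuous
    (fun a : BarSimplex V W m k × stdSimplex ℝ (Fin (k + 1)) => a.1.toSphere a.2) := by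
  let y : BarSimplex V W m k × stdSimplex ℝ (Fin (k + 1)) → Cn m ⊗[ℂ] W := fun a =>
    ∑ j, EuclideanSpace.single j (1 : ℂ) ⊗ₜ[ℂ] a.1.polar a.2 (EuclideanSpace.single j 1)
  have hy : ∀ a, LinearMap.lTensor (Cn m) (LinearMap.range a.1.zRight.toLinearMap)ᗮ.subtype
      (a.1.polarTensor a.2) = y a := fun a => lTensor_homToTensor _ _
  have hyc : Continuous y := by
    refine continuous_finsetSum _ fun j _ => ?_
    exact (TensorProduct.mkL ℂ (Cn m) W (EuclideanSpace.single j 1)).continuous.comp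
      (continuous_polar.clm_apply continuous_const)
  have hyn : ∀ a, ‖a.1.polarTensor a.2‖ = ‖y a‖ := fun a => by
    rw [← hy, norm_lTensor_subtype]
  have hq : Topology.IsInducing (fun q : ComplementBundle V W m => (q.f.toContinuousLinearMap,
      LinearMap.lTensor (Cn m) (LinearMap.range q.f.toLinearMap)ᗮ.subtype q.x)) := ⟨rfl⟩
  refine Continuous.subtype_mk (hq.continuous_iff.2 ?_) _
  refine Continuous.prodMk ?_ ?_
  · exact continuous_snd.comp (continuous_snd.comp
      ((isInducing_maps (V := V) (W := W) (m := m) (k := k)).continuous.comp continuous_fst))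
  · have : ∀ a : BarSimplex V W m k × stdSimplex ℝ (Fin (k + 1)),
        LinearMap.lTensor (Cn m) (LinearMap.range (a.1.toSphere a.2).1.f.toLinearMap)ᗮ.subtype
          (a.1.toSphere a.2).1.x = ((‖y a‖⁻¹ : ℝ) : ℂ) • y a := fun a => by
      rw [← hyn, ← hy, ← map_smul]
      rfl
    refine Continuous.congr ?_ fun a => (this a).symm
    refine Continuous.fun_smul (Complex.continuous_ofReal.comp (hyc.norm.inv₀ fun a => ?_)) hyc
    rw [← hyn]
    exact (a.1.norm_polarTensor_pos a.2).ne'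

end BarSimplex

end

section

variable {V V' : Type u} {W W' : Type v}
  [NormedAddCommGroup V] [InnerProductSpace ℂ V]
  [NormedAddCommGroup V'] [InnerProductSpace ℂ V']
  [NormedAddCommGroup W] [InnerProductSpace ℂ W]
  [NormedAddCommGroup W'] [InnerProductSpace ℂ W']
  {m k l : ℕ}

/-! ### Nondegenerate representatives -/

theorem stdSimplex_eq_map_succAbove (p : stdSimplex ℝ (Fin (k + 2))) {i : Fin (k + 2)}
    (hi : p i = 0) : ∃ p' : stdSimplex ℝ (Fin (k + 1)), stdSimplex.map i.succAbove p' = p := by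
  refine ⟨⟨fun j => p (i.succAbove j), fun j => p.2.1 _, ?_⟩, ?_⟩
  · have := stdSimplex.sum_eq_one p
    rwa [Fin.sum_univ_succAbove _ i, hi, zero_add] at this
  · ext j
    rw [stdSimplex.map_coe, FunOnFinite.linearMap_apply_apply, Finset.sum_filter]
    rcases Fin.eq_self_or_eq_succAbove i j with rfl | ⟨j, rfl⟩
    · exact (Finset.sum_eq_zero fun r _ => if_neg (Fin.succAbove_ne _ r)).trans hi.symm
    · simp only [Fin.succAbove_right_inj, Finset.sum_ite_eq', Finset.mem_univ, if_true]
      rfl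

/-- Here `θ` need not be the identity: it may move indices among equal terms of the chain, as the
degeneracy argument requires. -/
theorem BarSimplex.pull_eq_self (b : BarSimplex V W m k) (θ : Fin (k + 1) →o Fin (k + 1))
    (h : ∀ i, b.chain (θ i) = b.chain i) : b.pull θ = b := by
  refine ext_maps (funext h) (fun c => ?_) fun v => pull_zRight θ b v
  rw [pull_zLeft, h 0, ← sub_eq_zero, ← map_sub, ← neg_eq_zero, ← map_neg, neg_sub]
  exact b.zLeft_apply_of_orthogonal (Submodule.sub_starProjection_mem_orthogonal c)

/-- Positive barycentric coordinates on a simplex whose chain is strictly decreasing. -/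
def IsNondegenerate (b : BarSimplex V W m k) (p : stdSimplex ℝ (Fin (k + 1))) : Prop :=
  (∀ i, 0 < p i) ∧ StrictAnti b.chain

namespace Hocolim

theorem mk_pull (θ : Fin (l + 1) →o Fin (k + 1)) (b : BarSimplex V W m k)
    (p : stdSimplex ℝ (Fin (l + 1))) : mk (b.pull θ) p = mk b (stdSimplex.map θ p) :=
  Quot.sound (HocolimRel.glue θ b p)

/-- A repeated term of the chain makes the simplex degenerate; a vanishing weight puts the point on
a face. Either way the dimension drops. -/
theorem exists_mk_eq_of_not_isNondegenerate (b : BarSimplex V W m k)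
    (p : stdSimplex ℝ (Fin (k + 1))) (h : ¬ IsNondegenerate b p) :
    ∃ l < k, ∃ (b' : BarSimplex V W m l) (p' : stdSimplex ℝ (Fin (l + 1))),
      mk b' p' = mk b p := by
  by_cases hp : ∀ i, 0 < p i
  · have hs : ¬ StrictAnti b.chain := fun hs => h ⟨hp, hs⟩
    rw [Fin.strictAnti_iff_succ_lt] at hs
    push Not at hs
    obtain ⟨i, hi⟩ := hs
    have hi' : b.chain i.castSucc = b.chain i.succ :=
      ((b.antitone i.castSucc_lt_succ.le).lt_or_eq.resolve_left hi).symm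
    cases k with
    | zero => exact i.elim0
    | succ k =>
      -- `σ` omits the second copy of the repeated term. The composite `σ ∘ θ` moves only `i.succ`,
      -- to the index `i.castSucc` with the same subspace, so `b` is a degeneracy of `b.pull σ`.
      let σ : Fin (k + 1) →o Fin (k + 2) := (Fin.succAboveOrderEmb i.succ).toOrderHom
      let θ : Fin (k + 2) →o Fin (k + 1) := Fin.predAboveOrderHom i
      refine ⟨k, k.lt_succ_self, b.pull σ, stdSimplex.map θ p, ?_⟩
      rw [← mk_pull]
      have : (b.pull σ).pull θ = b := by
        refine BarSimplex.pull_eq_self b (σ.comp θ) fun j => ?_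
        change b.chain (i.succ.succAbove (i.predAbove j)) = b.chain j
        by_cases hj : j = i.succ
        · rw [hj, Fin.predAbove_succ_self, Fin.succAbove_succ_self, hi']
        · rw [Fin.succ_succAbove_predAbove hj]
      rw [this]
  · push Not at hp
    obtain ⟨i, hi⟩ := hp
    have hi0 : p i = 0 := le_antisymm hi (stdSimplex.zero_le p i)
    cases k with
    | zero =>
      have := stdSimplex.sum_eq_one p
      rw [Fin.sum_univ_one, ← Fin.fin_one_eq_zero i, hi0] at this
      exact absurd this zero_ne_one
    | succ k =>
      obtain ⟨p', hp'⟩ := stdSimplex_eq_map_succAbove p hi0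
      refine ⟨k, k.lt_succ_self, b.pull (Fin.succAboveOrderEmb i).toOrderHom, p', ?_⟩
      rw [mk_pull, ← hp']
      rfl

theorem exists_isNondegenerate (a : Hocolim V W m) :
    ∃ (k : ℕ) (b : BarSimplex V W m k) (p : stdSimplex ℝ (Fin (k + 1))),
      IsNondegenerate b p ∧ mk b p = a := by
  obtain ⟨⟨k, b, p⟩, rfl⟩ := Quot.exists_rep a
  change ∃ (l : ℕ) (b' : BarSimplex V W m l) (p' : stdSimplex ℝ (Fin (l + 1))),
      IsNondegenerate b' p' ∧ mk b' p' = mk b p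
  induction k using Nat.strong_induction_on with
  | _ k ih =>
    by_cases h : IsNondegenerate b p
    · exact ⟨k, b, p, h, rfl⟩
    · obtain ⟨l, hl, b', p', e⟩ := exists_mk_eq_of_not_isNondegenerate b p h
      obtain ⟨r, b'', p'', h', e'⟩ := ih l hl b' p'
      exact ⟨r, b'', p'', h', e'.trans e⟩

end Hocolim

/-- The `k + 1` dimensions are distinct and lie between `1` and `m`. -/
theorem lt_of_strictAnti {G : Fin (k + 1) → NonzeroSubspace m} (hG : StrictAnti G) : k < m := by
  have hanti : StrictAnti fun i => Module.finrank ℂ (G i).1 := fun i j hij =>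
    Submodule.finrank_lt_finrank_of_lt (hG hij)
  have hpos : ∀ i, 1 ≤ Module.finrank ℂ (G i).1 := fun i =>
    Submodule.one_le_finrank_iff.2 (G i).2
  have hle : ∀ i, Module.finrank ℂ (G i).1 ≤ m := fun i =>
    (Submodule.finrank_le _).trans_eq (finrank_euclideanSpace_fin)
  have := Finset.card_le_card_of_injOn (s := Finset.univ) (t := Finset.Icc 1 m) _
    (fun i _ => Finset.mem_coe.2 (Finset.mem_Icc.2 ⟨hpos i, hle i⟩)) hanti.injective.injOn
  simpa using this

instance [FiniteDimensional ℂ V] [FiniteDimensional ℂ W] : CompactSpace (Hocolim V W m) := by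
  rw [← isCompact_univ_iff]
  have hc : ∀ k, Continuous (fun a : BarSimplex V W m k × stdSimplex ℝ (Fin (k + 1)) =>
      (Hocolim.mk a.1 a.2 : Hocolim V W m)) := fun k =>
    (continuous_quot_mk (X := PreHocolim V W m)).comp (continuous_sigmaMk
      (σ := fun k : ℕ => BarSimplex V W m k × stdSimplex ℝ (Fin (k + 1))) (i := k))
  have : (Set.univ : Set (Hocolim V W m)) = ⋃ k ∈ Finset.range m,
      Set.range (fun a : BarSimplex V W m k × stdSimplex ℝ (Fin (k + 1)) =>
        (Hocolim.mk a.1 a.2 : Hocolim V W m)) := by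
    refine (Set.eq_univ_of_forall fun a => ?_).symm
    obtain ⟨k, b, p, h, rfl⟩ := Hocolim.exists_isNondegenerate a
    exact Set.mem_biUnion (Finset.mem_coe.2 (Finset.mem_range.2 (lt_of_strictAnti h.2)))
      ⟨(b, p), rfl⟩
  rw [this]
  exact (Finset.range m).isCompact_biUnion fun k _ => isCompact_range (hc k)

variable [FiniteDimensional ℂ W] [FiniteDimensional ℂ W']

/-- The comparison map from the homotopy colimit to the sphere bundle. -/
def Hocolim.toSphere : Hocolim V W m → SphereBundle V W m :=
  Quot.lift (fun a => a.2.1.toSphere a.2.2) (by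
    rintro _ _ ⟨θ, b, p⟩
    exact BarSimplex.toSphere_pull θ b p)

theorem Hocolim.continuous_toSphere :
    Continuous (Hocolim.toSphere : Hocolim V W m → SphereBundle V W m) :=
  continuous_quot_lift _ (continuous_sigma fun _ => BarSimplex.continuous_toSphere)

theorem Hocolim.toSphere_map (g : V' →ₗᵢ[ℂ] V) (h : W →ₗᵢ[ℂ] W') (a : Hocolim V W m) :
    (Hocolim.map g h a).toSphere = SphereBundle.map g h a.toSphere := by
  obtain ⟨⟨k, b, p⟩, rfl⟩ := Quot.exists_rep a
  exact BarSimplex.toSphere_map g h b p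

end

/-! ### Spectral decomposition -/

theorem Iic_fin_succ {k : ℕ} (i : Fin k) :
    Finset.Iic i.succ = insert i.succ (Finset.Iic i.castSucc) := by
  ext j
  simp only [Finset.mem_Iic, Finset.mem_insert, Fin.le_def, Fin.ext_iff, Fin.val_succ,
    Fin.val_castSucc]
  omega

theorem sum_Iic_fin_succ {k : ℕ} (w : Fin (k + 1) → ℝ) (i : Fin k) :
    ∑ r ∈ Finset.Iic i.succ, w r = w i.succ + ∑ r ∈ Finset.Iic i.castSucc, w r := by
  rw [Iic_fin_succ, Finset.sum_insert]
  simp [Fin.le_def]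

theorem sum_Iic_fin_zero {k : ℕ} (w : Fin (k + 1) → ℝ) : ∑ r ∈ Finset.Iic 0, w r = w 0 := by
  have : Finset.Iic (0 : Fin (k + 1)) = {0} := by ext; simp
  rw [this, Finset.sum_singleton]

theorem sum_Iic_fin_last {k : ℕ} (w : Fin (k + 1) → ℝ) :
    ∑ r ∈ Finset.Iic (Fin.last k), w r = ∑ r, w r := by
  refine Finset.sum_congr ?_ fun _ _ => rfl
  ext j
  simp [Fin.le_last]

/-- Partial sums of the barycentric coordinates `λ_k⁻¹ (λ_0, λ_1 - λ_0, …)`. -/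
theorem sum_Iic_of_weights {k : ℕ} {lam w : Fin (k + 1) → ℝ} {c : ℝ} (h0 : w 0 = lam 0 / c)
    (hs : ∀ i : Fin k, w i.succ = (lam i.succ - lam i.castSucc) / c) (i : Fin (k + 1)) :
    ∑ r ∈ Finset.Iic i, w r = lam i / c := by
  induction i using Fin.induction with
  | zero => rw [sum_Iic_fin_zero, h0]
  | succ i ih => rw [sum_Iic_fin_succ, ih, hs, ← add_div, sub_add_cancel]

section

variable {E : Type*} [NormedAddCommGroup E] [InnerProductSpace ℂ E] [FiniteDimensional ℂ E]
  {ι : Type*}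

/-- A symmetric operator vanishes on the complement of its eigenspaces for nonzero eigenvalues. -/
theorem apply_eq_zero_of_orthogonal_eigenspaces {T : E →ₗ[ℂ] E} (hT : T.IsSymmetric)
    {lam : ι → ℝ} (h : ∀ μ : ℂ, μ ≠ 0 → Module.End.HasEigenvalue T μ → ∃ i, μ = (lam i : ℂ))
    {e : E} (he : e ∈ (⨆ i, Module.End.eigenspace T (lam i : ℂ))ᗮ) : T e = 0 := by
  have htop : (⨆ μ, Module.End.eigenspace T μ) = ⊤ := by
    rw [← Submodule.orthogonal_eq_bot_iff]
    exact hT.orthogonalComplement_iSup_eigenspaces_eq_bot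
  -- By the spectral theorem it suffices to check this on eigenvectors, where the kernel contributes
  -- nothing. Then `⟪T e, T e⟫ = ⟪e, T (T e)⟫ = 0`.
  have hrange : ∀ v, T v ∈ ⨆ i, Module.End.eigenspace T (lam i : ℂ) := by
    intro v
    have hle : (⨆ μ, Module.End.eigenspace T μ) ≤
        (⨆ i, Module.End.eigenspace T (lam i : ℂ)).comap T := by
      refine iSup_le fun μ w hw => ?_
      rw [Submodule.mem_comap, Module.End.mem_eigenspace_iff.1 hw]
      by_cases hμ : μ = 0
      · rw [hμ, zero_smul]
        exact zero_mem _
      by_cases hw0 : w = 0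
      · rw [hw0, smul_zero]
        exact zero_mem _
      obtain ⟨i, rfl⟩ := h μ hμ (Module.End.hasEigenvalue_of_hasEigenvector ⟨hw, hw0⟩)
      exact Submodule.smul_mem _ _
        (Submodule.mem_iSup_of_mem (p := fun i => Module.End.eigenspace T (lam i : ℂ)) i hw)
    exact hle (htop ▸ Submodule.mem_top)
  rw [← inner_self_eq_zero (𝕜 := ℂ), hT]
  exact Submodule.inner_left_of_mem_orthogonal (hrange _) he

end

section

variable {V : Type u} {W : Type v}
  [NormedAddCommGroup V] [InnerProductSpace ℂ V]
  [NormedAddCommGroup W] [InnerProductSpace ℂ W] [FiniteDimensional ℂ W]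
  {m k l : ℕ}

namespace IsSpectralData

variable {q : ComplementBundle V W m} {lam : Fin (k + 1) → ℝ} {b : BarSimplex V W m k}
  {p : stdSimplex ℝ (Fin (k + 1))}

theorem chain_zero (h : IsSpectralData q lam b p) :
    (b.chain 0).1 = ⨆ i, q.gram.eigenspace (lam i : ℂ) := by
  simp [h.chain_eq 0]

theorem eigenspace_le (h : IsSpectralData q lam b p) (i : Fin (k + 1)) :
    q.gram.eigenspace (lam i : ℂ) ≤ (b.chain 0).1 := by
  rw [h.chain_zero]
  exact le_iSup (fun i => q.gram.eigenspace (lam i : ℂ)) i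

theorem zLeft_eq (h : IsSpectralData q lam b p) {i : Fin (k + 1)} {c : Cn m}
    (hc : c ∈ q.gram.eigenspace (lam i : ℂ)) :
    b.zLeft c = (((√(lam i))⁻¹ : ℝ) : ℂ) • (q.hom c : W) := by
  rw [← h.z_left i ⟨c, h.eigenspace_le i hc⟩ hc, ← BarSimplex.zLeft_apply_of_mem]

theorem isOrtho (h : IsSpectralData q lam b p) (i j : Fin (k + 1)) (hij : i ≠ j) :
    q.gram.eigenspace (lam i : ℂ) ⟂ q.gram.eigenspace (lam j : ℂ) :=
  q.gram_isSymmetric.orthogonalFamily_eigenspaces.isOrtho fun e =>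
    hij (h.strictMono.injective (Complex.ofReal_injective e))

theorem sum_Iic (h : IsSpectralData q lam b p) (i : Fin (k + 1)) :
    ∑ r ∈ Finset.Iic i, p r = lam i / lam (Fin.last k) :=
  sum_Iic_of_weights h.weight_zero h.weight_succ i

theorem hom_eq_zero (h : IsSpectralData q lam b p) {e : Cn m} (he : e ∈ (b.chain 0).1ᗮ) :
    (q.hom e : W) = 0 := by
  rw [← inner_self_eq_zero (𝕜 := ℂ), ← q.inner_gram]
  rw [h.chain_zero] at he
  rw [apply_eq_zero_of_orthogonal_eigenspaces q.gram_isSymmetric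
    (fun μ h0 hμ => (h.eigenvalue_iff μ).1 ⟨h0, hμ⟩) he, inner_zero_left]

/-- The simplex given by spectral data of a point represents that point. -/
theorem toSphere_eq {s : SphereBundle V W m} (h : IsSpectralData s.1 lam b p) :
    b.toSphere p = s := by
  have hl := h.pos (Fin.last k)
  -- On `E(λ_i)` the factor `√S` is `√(λ_i / λ_k)` and `z` is `x / √λ_i`; the product is `x / √λ_k`,
  -- with a constant independent of `i`.
  refine b.toSphere_eq_of_smul p h.z_right (inv_pos.2 (Real.sqrt_pos.2 hl)) fun v => ?_
  have key : (b.polar p).toLinearMap = (((√(lam (Fin.last k)))⁻¹ : ℝ) : ℂ) •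
      ((LinearMap.range s.1.f.toLinearMap)ᗮ.subtype ∘ₗ s.1.hom) := by
    refine eq_of_eqOn_family (fun i => s.1.gram.eigenspace (lam i : ℂ)) (fun i e he => ?_)
      fun e he => ?_
    · change b.polar p e = (((√(lam (Fin.last k)))⁻¹ : ℝ) : ℂ) • (s.1.hom e : W)
      have hS := chainOperator_apply_of_mem (p := p) h.isOrtho h.chain_eq he
      rw [h.sum_Iic] at hS
      rw [b.polar_apply_of_eigenvector p (div_nonneg (h.pos i).le hl.le) hS, h.zLeft_eq he,
        smul_smul, ← Complex.ofReal_mul]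
      congr 2
      have := (Real.sqrt_pos.2 (h.pos i)).ne'
      rw [Real.sqrt_div (h.pos i).le]
      field_simp
    · change b.polar p e = (((√(lam (Fin.last k)))⁻¹ : ℝ) : ℂ) • (s.1.hom e : W)
      rw [← h.chain_zero] at he
      rw [h.hom_eq_zero he, b.polar_apply_of_orthogonal p he, smul_zero]
  exact congrArg (fun A : Cn m →ₗ[ℂ] W => A v) key

theorem range_subset {lam' : Fin (l + 1) → ℝ} {b' : BarSimplex V W m l}
    {p' : stdSimplex ℝ (Fin (l + 1))} (h : IsSpectralData q lam b p)
    (h' : IsSpectralData q lam' b' p') : Set.range lam ⊆ Set.range lam' := by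
  rintro _ ⟨i, rfl⟩
  obtain ⟨j, hj⟩ := (h'.eigenvalue_iff _).1 ((h.eigenvalue_iff (lam i)).2 ⟨i, rfl⟩)
  exact ⟨j, (Complex.ofReal_injective hj).symm⟩

/-- Spectral data are unique. -/
theorem mk_eq_mk {lam' : Fin (l + 1) → ℝ} {b' : BarSimplex V W m l}
    {p' : stdSimplex ℝ (Fin (l + 1))} (h : IsSpectralData q lam b p)
    (h' : IsSpectralData q lam' b' p') : Hocolim.mk b p = Hocolim.mk b' p' := by
  have hr : Set.range lam = Set.range lam' := (h.range_subset h').antisymm (h'.range_subset h)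
  obtain rfl : k = l := by
    have := congrArg Set.ncard hr
    rw [← Set.image_univ, ← Set.image_univ, Set.ncard_image_of_injective _ h.strictMono.injective,
      Set.ncard_image_of_injective _ h'.strictMono.injective] at this
    simpa using this
  obtain rfl : lam = lam' := (StrictMono.range_inj h.strictMono h'.strictMono).1 hr
  have hchain : b.chain = b'.chain :=
    funext fun r => Subtype.ext ((h.chain_eq r).trans (h'.chain_eq r).symm)
  have hz : b.zLeft.toLinearMap = b'.zLeft.toLinearMap := by
    refine eq_of_eqOn_family (fun i => q.gram.eigenspace (lam i : ℂ)) (fun i e he => ?_)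
      fun e he => ?_
    · exact (h.zLeft_eq he).trans (h'.zLeft_eq he).symm
    · exact (b.zLeft_apply_of_orthogonal (h.chain_zero ▸ he)).trans
        (b'.zLeft_apply_of_orthogonal (h'.chain_zero ▸ he)).symm
  obtain rfl : b = b' := BarSimplex.ext_maps hchain
    (fun c => congrArg (fun A : Cn m →ₗ[ℂ] W => A c) hz)
    fun v => (h.z_right v).trans (h'.z_right v).symm
  obtain rfl : p = p' := by
    refine stdSimplex.ext (funext fun i => ?_)
    cases i using Fin.cases with
    | zero => exact h.weight_zero.trans h'.weight_zero.symm
    | succ i => exact (h.weight_succ i).trans (h'.weight_succ i).symm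
  rfl

end IsSpectralData

/-- A nondegenerate simplex is given by spectral data of the point which it represents. -/
theorem IsNondegenerate.isSpectralData {b : BarSimplex V W m k} {p : stdSimplex ℝ (Fin (k + 1))}
    (h : IsNondegenerate b p) :
    IsSpectralData (b.toSphere p).1
      (fun i => ‖b.polarTensor p‖⁻¹ ^ 2 * ∑ r ∈ Finset.Iic i, p r) b p := by
  obtain ⟨hp, hs⟩ := h
  obtain ⟨D, hD0, hDo, hG⟩ := exists_orthogonal_family_of_strictAnti
    (G := fun i => (b.chain i).1) (fun i j hij => hs hij) fun i => (b.chain i).2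
  -- The operator `x^* x` is `N² S`, and `S` has eigenvalues the partial sums `t i`. Since `t` ends
  -- at `1`, the largest eigenvalue is `N²`, and dividing by it returns the original weights.
  set N := ‖b.polarTensor p‖⁻¹ with hNdef
  have hN : 0 < N := inv_pos.2 (b.norm_polarTensor_pos p)
  set t : Fin (k + 1) → ℝ := fun i => ∑ r ∈ Finset.Iic i, p r with ht
  have htpos : ∀ i, 0 < t i := fun i =>
    Finset.sum_pos (fun r _ => hp r) ⟨i, Finset.mem_Iic.2 le_rfl⟩
  have htmono : StrictMono t := fun i j hij =>
    Finset.sum_lt_sum_of_subset (Finset.Iic_subset_Iic.2 hij.le) (Finset.mem_Iic.2 le_rfl)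
      (fun hj => hij.not_ge (Finset.mem_Iic.1 hj)) (hp j) fun r _ _ => (hp r).le
  have htlast : t (Fin.last k) = 1 := by
    rw [ht]
    exact (sum_Iic_fin_last _).trans (stdSimplex.sum_eq_one p)
  set lam : Fin (k + 1) → ℝ := fun i => N ^ 2 * t i with hlam
  have hlpos : ∀ i, 0 < lam i := fun i => mul_pos (pow_pos hN 2) (htpos i)
  have hlmono : StrictMono lam := fun i j hij =>
    mul_lt_mul_of_pos_left (htmono hij) (pow_pos hN 2)
  have hG0 : (b.chain 0).1 = ⨆ i, D i := by simpa using hG 0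
  have hS : ∀ i, ∀ e ∈ D i, chainOperator b.chain p e = (t i : ℂ) • e := fun i e he =>
    chainOperator_apply_of_mem hDo hG he
  have hT : ∀ i, ∀ e ∈ D i, (b.toSphere p).1.gram e = (lam i : ℂ) • e := fun i e he => by
    rw [b.toSphere_gram, hS i e he, smul_smul, ← Complex.ofReal_mul]
  have hT0 : ∀ e ∈ (⨆ i, D i)ᗮ, (b.toSphere p).1.gram e = 0 := fun e he => by
    rw [b.toSphere_gram, chainOperator_apply_of_orthogonal b.antitone _ (hG0 ▸ he), smul_zero]
  have hsymm := (b.toSphere p).1.gram_isSymmetric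
  have hE : ∀ i, (b.toSphere p).1.gram.eigenspace (lam i : ℂ) = D i :=
    eigenspace_eq_of_family hsymm hlmono.injective (fun i => (hlpos i).ne') hT hT0
  refine ⟨hlpos, hlmono, fun μ => ⟨fun hμ => exists_eq_of_hasEigenvalue hsymm hT hT0 hμ.1 hμ.2,
    ?_⟩, fun r => ?_, fun v => rfl, fun i c hc => ?_, ?_, fun i => ?_⟩
  · rintro ⟨i, rfl⟩
    refine ⟨by exact_mod_cast (hlpos i).ne', ?_⟩
    rw [Module.End.hasEigenvalue_iff, hE]
    exact hD0 i
  · simp only [hE]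
    exact hG r
  · rw [hE] at hc
    rw [← BarSimplex.zLeft_apply_of_mem, b.toSphere_hom,
      b.polar_apply_of_eigenvector p (htpos i).le (hS i _ hc), smul_smul, smul_smul,
      ← Complex.ofReal_mul, ← Complex.ofReal_mul]
    have h1 : (√(lam i))⁻¹ * (N * √(t i)) = 1 := by
      have : √(lam i) = N * √(t i) := by
        rw [hlam, Real.sqrt_mul (sq_nonneg N), Real.sqrt_sq hN.le]
      rw [this, inv_mul_cancel₀]
      exact (mul_pos hN (Real.sqrt_pos.2 (htpos i))).ne'
    rw [mul_assoc, h1, Complex.ofReal_one, one_smul]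
  · change p 0 = N ^ 2 * t 0 / (N ^ 2 * t (Fin.last k))
    rw [htlast, mul_one, mul_div_cancel_left₀ _ (pow_pos hN 2).ne', ht]
    exact (sum_Iic_fin_zero _).symm
  · change p i.succ = (N ^ 2 * t i.succ - N ^ 2 * t i.castSucc) / (N ^ 2 * t (Fin.last k))
    have : t i.succ = p i.succ + t i.castSucc := sum_Iic_fin_succ _ i
    rw [htlast, mul_one, ← mul_sub, mul_div_cancel_left₀ _ (pow_pos hN 2).ne', this,
      add_sub_cancel_right]

theorem ComplementBundle.eigenvalue_nonneg (q : ComplementBundle V W m) {μ : ℝ}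
    (h : q.gram.HasEigenvalue (μ : ℂ)) : 0 ≤ μ := by
  obtain ⟨v, hv⟩ := h.exists_hasEigenvector
  have h1 := q.inner_gram v v
  rw [hv.apply_eq_smul, inner_smul_left, Complex.conj_ofReal, inner_self_eq_norm_sq_to_K,
    inner_self_eq_norm_sq_to_K] at h1
  have h2 : μ * ‖v‖ ^ 2 = ‖(q.hom v : W)‖ ^ 2 := by
    apply Complex.ofReal_injective
    push_cast
    exact h1
  have h3 : 0 < ‖v‖ ^ 2 := pow_pos (norm_pos_iff.2 hv.2) 2
  exact nonneg_of_mul_nonneg_left (h2 ▸ sq_nonneg _) h3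

/-- The distinct nonzero eigenvalues of `x^* x`, in increasing order. -/
theorem SphereBundle.exists_eigenvalues (s : SphereBundle V W m) :
    ∃ (k : ℕ) (lam : Fin (k + 1) → ℝ), (∀ i, 0 < lam i) ∧ StrictMono lam ∧
      ∀ μ : ℂ, (μ ≠ 0 ∧ s.1.gram.HasEigenvalue μ) ↔ ∃ i, μ = (lam i : ℂ) := by
  have hsymm := s.1.gram_isSymmetric
  have hfin : {μ : ℝ | μ ≠ 0 ∧ s.1.gram.HasEigenvalue (μ : ℂ)}.Finite :=
    ((Module.End.finite_hasEigenvalue s.1.gram).preimage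
      Complex.ofReal_injective.injOn).subset fun μ h => h.2
  have hreal : ∀ μ : ℂ, s.1.gram.HasEigenvalue μ → ((μ.re : ℝ) : ℂ) = μ := fun μ h =>
    Complex.conj_eq_iff_re.1 (hsymm.conj_eigenvalue_eq_self h)
  have hmem : ∀ μ : ℝ, μ ∈ hfin.toFinset ↔ μ ≠ 0 ∧ s.1.gram.HasEigenvalue (μ : ℂ) := fun μ =>
    hfin.mem_toFinset
  have hcard : 0 < hfin.toFinset.card := by
    rw [Finset.card_pos]
    by_contra hne
    rw [Finset.not_nonempty_iff_eq_empty] at hne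
    -- With no nonzero eigenvalue, the vanishing lemma for an empty family gives `x^* x = 0`, hence
    -- `x = 0`, contradicting norm one.
    have hno : ∀ μ : ℂ, μ ≠ 0 → s.1.gram.HasEigenvalue μ →
        ∃ i : Empty, μ = ((Empty.elim i : ℝ) : ℂ) := fun μ h0 h => by
      have : μ.re ∈ hfin.toFinset := (hmem _).2
        ⟨fun h' => h0 (by rw [← hreal μ h, h', Complex.ofReal_zero]), by rwa [hreal μ h]⟩
      rw [hne] at this
      exact absurd this (Finset.notMem_empty _)
    obtain ⟨v, hv⟩ := s.exists_hom_ne_zero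
    have : s.1.gram v = 0 :=
      apply_eq_zero_of_orthogonal_eigenspaces hsymm hno (by
        rw [iSup_of_empty, Submodule.bot_orthogonal_eq_top]
        exact Submodule.mem_top)
    have h1 := s.1.inner_gram v v
    rw [this, inner_zero_left] at h1
    exact hv (Subtype.ext (inner_self_eq_zero.1 h1.symm))
  obtain ⟨k, hk⟩ := Nat.exists_eq_succ_of_ne_zero hcard.ne'
  have hrange := Finset.range_orderEmbOfFin _ hk
  have hin : ∀ i, hfin.toFinset.orderEmbOfFin hk i ∈ hfin.toFinset := fun i =>
    Finset.orderEmbOfFin_mem _ hk i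
  refine ⟨k, hfin.toFinset.orderEmbOfFin hk, fun i => ?_, (Finset.orderEmbOfFin _ hk).strictMono,
    fun μ => ⟨fun h => ?_, ?_⟩⟩
  · have := (hmem _).1 (hin i)
    exact (s.1.eigenvalue_nonneg this.2).lt_of_ne' this.1
  · have : μ.re ∈ Set.range (hfin.toFinset.orderEmbOfFin hk) := by
      rw [hrange]
      exact Finset.mem_coe.2 ((hmem _).2
        ⟨fun h' => h.1 (by rw [← hreal μ h.2, h', Complex.ofReal_zero]),
          by rw [hreal μ h.2]; exact h.2⟩)
    obtain ⟨i, hi⟩ := this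
    exact ⟨i, by rw [hi, hreal μ h.2]⟩
  · rintro ⟨i, rfl⟩
    have := (hmem _).1 (hin i)
    exact ⟨by exact_mod_cast this.1, this.2⟩

/-- The weights `λ_k⁻¹ (λ_0, λ_1 - λ_0, …, λ_k - λ_{k-1})`. -/
theorem exists_weights {lam : Fin (k + 1) → ℝ} (hpos : ∀ i, 0 < lam i) (hmono : StrictMono lam) :
    ∃ p : stdSimplex ℝ (Fin (k + 1)), p.1 0 = lam 0 / lam (Fin.last k) ∧
      ∀ i : Fin k, p.1 i.succ = (lam i.succ - lam i.castSucc) / lam (Fin.last k) := by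
  let w : Fin (k + 1) → ℝ := Fin.cases (lam 0 / lam (Fin.last k))
    fun i => (lam i.succ - lam i.castSucc) / lam (Fin.last k)
  refine ⟨⟨w, fun i => ?_, ?_⟩, rfl, fun i => rfl⟩
  · cases i using Fin.cases with
    | zero => exact (div_pos (hpos 0) (hpos _)).le
    | succ i => exact div_nonneg (sub_nonneg.2 (hmono i.castSucc_lt_succ).le) (hpos _).le
  · rw [← sum_Iic_fin_last, sum_Iic_of_weights (lam := lam) rfl (fun i => rfl),
      div_self (hpos _).ne']

/-- Every point of the sphere bundle has spectral data. -/
theorem SphereBundle.exists_isSpectralData (s : SphereBundle V W m) :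
    ∃ (k : ℕ) (lam : Fin (k + 1) → ℝ) (b : BarSimplex V W m k)
      (p : stdSimplex ℝ (Fin (k + 1))), IsSpectralData s.1 lam b p := by
  obtain ⟨k, lam, hpos, hmono, hiff⟩ := s.exists_eigenvalues
  obtain ⟨p, hp0, hps⟩ := exists_weights hpos hmono
  have hsymm := s.1.gram_isSymmetric
  let D : Fin (k + 1) → Submodule ℂ (Cn m) := fun i => s.1.gram.eigenspace (lam i : ℂ)
  have hDo : ∀ i j, i ≠ j → D i ⟂ D j := fun i j hij =>
    hsymm.orthogonalFamily_eigenspaces.isOrtho fun e =>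
      hij (hmono.injective (Complex.ofReal_injective e))
  have hD0 : ∀ i, D i ≠ ⊥ := fun i =>
    Module.End.hasEigenvalue_iff.1 ((hiff _).2 ⟨i, rfl⟩).2
  let G : Fin (k + 1) → NonzeroSubspace m := fun r =>
    ⟨⨆ i, ⨆ _ : r ≤ i, D i, fun h => hD0 r (eq_bot_iff.2 (h ▸
      le_iSup₂_of_le (f := fun i (_ : r ≤ i) => D i) r le_rfl le_rfl))⟩
  have hG : Antitone G := fun r r' hr => iSup₂_le fun i hi =>
    le_iSup₂_of_le (f := fun i (_ : r ≤ i) => D i) i (hr.trans hi) le_rfl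
  -- `M` is the inverse square root of `x^* x` on the sum of its nonzero eigenspaces, and zero on
  -- the complement. Thus `x ∘ M` is the partial isometry of the polar decomposition of `x`.
  let M : Cn m →ₗ[ℂ] Cn m :=
    ∑ i, (((√(lam i))⁻¹ : ℝ) : ℂ) • (D i).starProjection.toLinearMap
  have hMapply : ∀ v, M v = ∑ i, (((√(lam i))⁻¹ : ℝ) : ℂ) • (D i).starProjection v := fun v => by
    simp [M]
  have hM : ∀ i, ∀ e ∈ D i, M e = (((√(lam i))⁻¹ : ℝ) : ℂ) • e := fun i e he => by
    rw [hMapply, Finset.sum_eq_single i]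
    · rw [Submodule.starProjection_eq_self_iff.2 he]
    · intro j _ hj
      rw [(Submodule.starProjection_apply_eq_zero_iff _).2, smul_zero]
      exact hDo i j hj.symm he
    · exact fun h => absurd (Finset.mem_univ i) h
  have hMsymm : ∀ u v, ⟪M u, v⟫_ℂ = ⟪u, M v⟫_ℂ := fun u v => by
    simp only [hMapply, sum_inner, inner_sum, inner_smul_left, inner_smul_right,
      Complex.conj_ofReal, Submodule.inner_starProjection_left_eq_right]
  have hMTM : ∀ c ∈ (G 0).1, M (s.1.gram (M c)) = c := by
    have : (G 0).1 ≤ LinearMap.eqLocus (M ∘ₗ s.1.gram ∘ₗ M) LinearMap.id := by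
      refine iSup₂_le fun i _ e he => ?_
      change M (s.1.gram (M e)) = e
      rw [hM i e he, map_smul, Module.End.mem_eigenspace_iff.1 he, map_smul, map_smul, hM i e he,
        smul_smul, smul_smul, ← Complex.ofReal_mul, ← Complex.ofReal_mul]
      have h1 : (√(lam i))⁻¹ * (lam i * (√(lam i))⁻¹) = 1 := by
        have h2 := (Real.sqrt_pos.2 (hpos i)).ne'
        have h3 := Real.mul_self_sqrt (hpos i).le
        field_simp
        linarith
      rw [mul_assoc, h1, Complex.ofReal_one, one_smul]
    exact fun c hc => this hc
  let A : Cn m →ₗ[ℂ] W := (LinearMap.range s.1.f.toLinearMap)ᗮ.subtype ∘ₗ s.1.hom ∘ₗ M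
  have hA : ∀ c ∈ (G 0).1, ‖A c‖ = ‖c‖ := fun c hc => by
    have h1 : ⟪A c, A c⟫_ℂ = ⟪c, c⟫_ℂ := by
      change ⟪(s.1.hom (M c) : W), (s.1.hom (M c) : W)⟫_ℂ = _
      rw [← s.1.inner_gram, ← hMsymm, hMTM c hc]
    rw [@norm_eq_sqrt_re_inner ℂ, @norm_eq_sqrt_re_inner ℂ, h1]
  have hBA : ∀ c ∈ (G 0).1, ∀ v, ⟪s.1.f v, A c⟫_ℂ = 0 := fun c _ v =>
    (Submodule.mem_orthogonal _ _).1 (s.1.hom (M c)).2 (s.1.f v) ⟨v, rfl⟩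
  refine ⟨k, lam, BarSimplex.ofMaps G hG A s.1.f hA hBA, p, hpos, hmono, hiff, fun r => rfl,
    BarSimplex.ofMaps_zRight G hG A s.1.f hA hBA, fun i c hc => ?_, hp0, hps⟩
  rw [← BarSimplex.zLeft_apply_of_mem, BarSimplex.ofMaps_zLeft]
  refine (congrArg A ((Submodule.starProjection_eq_self_iff (K := (G 0).1)).2 c.2)).trans ?_
  change (s.1.hom (M c) : W) = _
  rw [hM i c hc, map_smul]
  rfl

theorem Hocolim.toSphere_bijective :
    Function.Bijective (Hocolim.toSphere : Hocolim V W m → SphereBundle V W m) := by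
  constructor
  · intro a a' h
    obtain ⟨k, b, p, hb, rfl⟩ := Hocolim.exists_isNondegenerate a
    obtain ⟨k', b', p', hb', rfl⟩ := Hocolim.exists_isNondegenerate a'
    have h1 := hb.isSpectralData
    -- Both nondegenerate simplices now carry spectral data of one and the same point, so uniqueness
    -- applies.
    rw [show b.toSphere p = b'.toSphere p' from h] at h1
    exact h1.mk_eq_mk hb'.isSpectralData
  · intro s
    obtain ⟨k, lam, b, p, h⟩ := s.exists_isSpectralData
    exact ⟨Hocolim.mk b p, h.toSphere_eq⟩

variable (V W m) in
/-- The homeomorphism from the homotopy colimit to the sphere bundle. -/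
def hocolimHomeomorph [FiniteDimensional ℂ V] : Hocolim V W m ≃ₜ SphereBundle V W m :=
  Continuous.homeoOfEquivCompactToT2
    (f := Equiv.ofBijective Hocolim.toSphere Hocolim.toSphere_bijective)
    Hocolim.continuous_toSphere

end

end UnitaryCalculus

end

theorem mainTheorem5 (n : ℕ) :
    ∃ Φ : ∀ (V : Type u) (W : Type v)
        [NormedAddCommGroup V] [InnerProductSpace ℂ V] [FiniteDimensional ℂ V]
        [NormedAddCommGroup W] [InnerProductSpace ℂ W] [FiniteDimensional ℂ W],
        UnitaryCalculus.Hocolim V W (n + 1) ≃ₜ UnitaryCalculus.SphereBundle V W (n + 1),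
      -- naturality in `V` and `W`
      (∀ (V V' : Type u) (W W' : Type v)
        [NormedAddCommGroup V] [InnerProductSpace ℂ V] [FiniteDimensional ℂ V]
        [NormedAddCommGroup V'] [InnerProductSpace ℂ V'] [FiniteDimensional ℂ V']
        [NormedAddCommGroup W] [InnerProductSpace ℂ W] [FiniteDimensional ℂ W]
        [NormedAddCommGroup W'] [InnerProductSpace ℂ W'] [FiniteDimensional ℂ W']
        (g : V' →ₗᵢ[ℂ] V) (h : W →ₗᵢ[ℂ] W') (a : UnitaryCalculus.Hocolim V W (n + 1)),
        Φ V' W' (UnitaryCalculus.Hocolim.map g h a) =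
          UnitaryCalculus.SphereBundle.map g h (Φ V W a)) ∧
      -- the description by the spectral decomposition of `x^* x`
      (∀ (V : Type u) (W : Type v)
        [NormedAddCommGroup V] [InnerProductSpace ℂ V] [FiniteDimensional ℂ V]
        [NormedAddCommGroup W] [InnerProductSpace ℂ W] [FiniteDimensional ℂ W]
        (s : UnitaryCalculus.SphereBundle V W (n + 1)),
        ∃ (k : ℕ) (lam : Fin (k + 1) → ℝ) (b : UnitaryCalculus.BarSimplex V W (n + 1) k)
          (p : stdSimplex ℝ (Fin (k + 1))),
          UnitaryCalculus.IsSpectralData s.1 lam b p ∧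
            (Φ V W).symm s = UnitaryCalculus.Hocolim.mk b p) := by
  refine ⟨fun V W => UnitaryCalculus.hocolimHomeomorph V W (n + 1),
    fun V V' W W' => UnitaryCalculus.Hocolim.toSphere_map, fun V W => ?_⟩
  intro _ _ _ _ _ _ s
  obtain ⟨k, lam, b, p, h⟩ := s.exists_isSpectralData
  refine ⟨k, lam, b, p, h, ?_⟩
  rw [Homeomorph.symm_apply_eq]
  exact h.toSphere_eq.symm
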